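/- For positive integers $n,k$ let $K(n,k)$ be the Kneser graph, whose vertices are the $k$-element subsets of $[n]=\{1,\dots,n\}$, two of them being adjacent if and only if they are disjoint. For $\mathcal F\subseteq\binom{[n]}{k}$ let $\Delta(K(n,k)[\mathcal F])$ denote the maximum degree of the subgraph of $K(n,k)$ induced by $\mathcal F$. For $i\in[n]$, the star $\mathcal D_i$ is the family $\{A\in\binom{[n]}{k}: i\in A\}$; a union of $s$ stars is a family $\bigcup_{i\in S}\mathcal D_i$ with $S\subseteq[n]$, $|S|=s$. For a real number $\lambda$ and an integer $t$ with $0\le t<n$ and $t\le\lambda\le t+1$, the family $\mathcal F$ has size parameter $\lambda$ if $$|\mathcal F|=\binom nk-\binom{n-t}k+(\lambda-t)\binom{n-t-1}{k-1};$$ for $\lambda=s$ a positive integer less than $n$ this says $|\mathcal F|=\binom nk-\binom{n-s}k$, the size of a union of $s$ stars. **Corollary.** (a) Let $n,k,s$ be positive integers with $n\ge 10000\,s^5k$, and let $\mathcal F\subseteq\binom{[n]}{k}$ have size parameter $\lambda=s$. If $\mathcal F$ minimizes the maximum degree over all induced subgraphs of $K(n,k)$ of the same order, i.e. $\Delta(K(n,k)[\mathcal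 F])\le\Delta(K(n,k)[\mathcal G])$ for all $\mathcal G\subseteq\binom{[n]}{k}$ with $|\mathcal G|=|\mathcal F|$, then $\mathcal F$ is a union of $s$ stars. (b) For integers $k\ge2$ and $l\ge1$, call $\mathcal F\subseteq\binom{[n]}{k}$ $(\le l)$-almost intersecting if $\Delta(K(n,k)[\mathcal F])\le l$. Let $n_0(k,l)$ be the least positive integer such that for all $n\ge n_0(k,l)$ the $(\le l)$-almost intersecting families $\mathcal F\subseteq\binom{[n]}{k}$ of largest size are exactly the stars $\mathcal D_i$, $i\in[n]$. Then $n_0(k,l)$ exists for all such $k,l$, and $n_0(k,l)=\Theta\bigl(k\,l^{1/(k-1)}\bigr)$ uniformly in $k$ and $l$: there are absolute constants $c,C>0$ such that $$c\,k\,l^{1/(k-1)}\le n_0(k,l)\le C\,k\,l^{1/(k-1)}\qquad\text{for all integers }k\ge2,\ l\ge1.$$ -/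

import Mathlib

/-- The vertices of the Kneser graph `K(n,k)`: the `k`-element subsets of an `n`-element set. -/
abbrev KSet (n k : ℕ) : Type := {A : Finset (Fin n) // A.card = k}

/-- The Kneser graph `K(n,k)`: two `k`-sets are adjacent iff they are disjoint. The condition `A ≠ B`
is automatic for `k ≥ 1` and only rules out a loop at the empty set when `k = 0`. -/
def kneserGraph (n k : ℕ) : SimpleGraph (KSet n k) where
  Adj A B := A ≠ B ∧ Disjoint A.1 B.1
  symm := ⟨fun _ _ h => ⟨h.1.symm, h.2.symm⟩⟩
  loopless := ⟨fun _ h => h.1 rfl⟩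

open Classical in
/-- `Δ(K(n,k)[F])`, the maximum degree of the subgraph of the Kneser graph induced by `F`. -/
noncomputable def inducedMaxDegree {n k : ℕ} (F : Finset (KSet n k)) : ℕ :=
  ((kneserGraph n k).induce (F : Set (KSet n k))).maxDegree

/-- The star `D_i`: all `k`-sets containing `i`. -/
def kneserStar (n k : ℕ) (i : Fin n) : Finset (KSet n k) :=
  Finset.univ.filter fun A => i ∈ A.1

/-- `F` is a union of `s` (distinct) stars. -/
def IsUnionOfStars {n k : ℕ} (s : ℕ) (F : Finset (KSet n k)) : Prop :=
  ∃ S : Finset (Fin n), S.card = s ∧ F = S.biUnion (kneserStar n k)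

/-- `F` has size parameter `lam`: for a natural number `t` with `t ≤ lam ≤ t + 1`,
`|F| = C(n,k) - C(n-t,k) + (lam - t) C(n-t-1,k-1)`. The side condition `t < n` keeps the
natural-number subtractions `n - t` and `n - t - 1` honest. -/
def HasSizeParameter {n k : ℕ} (F : Finset (KSet n k)) (lam : ℝ) : Prop :=
  ∃ t : ℕ, t < n ∧ (t : ℝ) ≤ lam ∧ lam ≤ (t : ℝ) + 1 ∧
    (F.card : ℝ) = (n.choose k : ℝ) - ((n - t).choose k : ℝ)
      + (lam - (t : ℝ)) * ((n - t - 1).choose (k - 1) : ℝ)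

/-- `F` minimizes the maximum degree over all induced subgraphs of `K(n,k)` of the same order. -/
def MinimizesMaxDegree {n k : ℕ} (F : Finset (KSet n k)) : Prop :=
  ∀ G : Finset (KSet n k), G.card = F.card → inducedMaxDegree F ≤ inducedMaxDegree G

/-- `F` is `(≤ l)`-almost intersecting. -/
def IsAlmostIntersecting {n k : ℕ} (l : ℕ) (F : Finset (KSet n k)) : Prop :=
  inducedMaxDegree F ≤ l

/-- `F` is a largest `(≤ l)`-almost intersecting family of `k`-subsets of an `n`-set. -/
def IsLargestAlmostIntersecting {n k : ℕ} (l : ℕ) (F : Finset (KSet n k)) : Prop :=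
  IsAlmostIntersecting l F ∧
    ∀ G : Finset (KSet n k), IsAlmostIntersecting l G → G.card ≤ F.card

/-- The positive integers `N` such that for all `n ≥ N` the largest `(≤ l)`-almost intersecting
families of `k`-subsets of an `n`-set are exactly the stars. -/
def starThresholds (k l : ℕ) : Set ℕ :=
  {N | 0 < N ∧ ∀ n : ℕ, N ≤ n → ∀ F : Finset (KSet n k),
    IsLargestAlmostIntersecting l F ↔ ∃ i : Fin n, F = kneserStar n k i}

/-- `N` is the number `n₀(k,l)`: the least element of `starThresholds k l`. -/
def IsStarThreshold (k l N : ℕ) : Prop :=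
  IsLeast (starThresholds k l) N

/-! ### Spectrum of the Kneser operator through the degree filtration. -/

section
open Finset
open scoped InnerProductSpace

/-! Let L = C(n-k-1, k-1), the number of sets of a star that are disjoint from a given set outside
it. In a union of s stars every degree is at most (s-1)L. Both parts follow from one stability
statement, `isUnionOfStars_of_disjDeg_le`: if F has the size of a union of s stars and its internal
degrees are at most (s-1+δ)L with sδ ≤ 1/10000, then F is a union of s stars.

The proof is spectral. The Kneser operator acts on level j of the degree filtration as the scalar
(-1)^j C(n-k-j, k-j). Split the indicator of F into its mean, a linear part g and a part of degree
at least two (`level_decomposition`). The last part contributes little to the degree sum of F; the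
mean contributes about sL per set and g contributes -L‖g‖². The degree bound therefore forces ‖g‖²
to be nearly |F|: the indicator is almost linear. Hölder's inequality and a fourth-moment bound
(`sum_linearFun_pow_four_le`) carry this over to the normalized point degrees y_i: ∑ y_i² ≤ s while
∑ y_i⁴ ≥ s - 1/500. So exactly s of them are near 1, and F contains almost all of s stars
(`exists_stars_close`).

Closeness becomes equality by mixing. With U the union of these stars, a set of F \ U has about sL
neighbours in U but at most (s-1+δ)L in F, hence nearly L neighbours in the symmetric difference of
F and U. That family is too small to be so dense unless it is empty.

For (a), a minimizer is compared with a union of stars (δ = 0). For (b), s = 1 covers 10000 l ≤ L,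
while for L ≤ l a star plus one set is still almost intersecting. The threshold is thus governed by
when C(n-k-1, k-1) passes l up to a constant factor, which happens for n of order k l^(1/(k-1)). -/

/-- The adjacency operator of the Kneser graph on real functions on `k`-sets. -/
noncomputable def kneserOp (n k : ℕ) :
    EuclideanSpace ℝ (KSet n k) →ₗ[ℝ] EuclideanSpace ℝ (KSet n k) :=
  Matrix.toEuclideanLin (Matrix.of fun A B => if Disjoint A.1 B.1 then (1 : ℝ) else 0)

lemma kneserOp_apply {n k : ℕ} (f : EuclideanSpace ℝ (KSet n k)) (A : KSet n k) :
    kneserOp n k f A = ∑ B, if Disjoint A.1 B.1 then f B else 0 := by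
  simp [kneserOp, Matrix.toEuclideanLin, Matrix.mulVec, dotProduct]

lemma kneserOp_isSymmetric (n k : ℕ) : (kneserOp n k).IsSymmetric := by
  unfold kneserOp
  rw [Matrix.isSymmetric_toEuclideanLin_iff]
  ext A B
  simp [disjoint_comm]

/-- The indicator function of the `k`-sets containing `J`. -/
noncomputable def containInd {n : ℕ} (k : ℕ) (J : Finset (Fin n)) : EuclideanSpace ℝ (KSet n k) :=
  WithLp.toLp 2 fun A => if J ⊆ A.1 then 1 else 0

lemma containInd_apply {n k : ℕ} (J : Finset (Fin n)) (A : KSet n k) :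
    containInd k J A = if J ⊆ A.1 then 1 else 0 := rfl

/-- The functions on `k`-sets of degree at most `j`. -/
noncomputable def degreeLE (n k j : ℕ) : Submodule ℝ (EuclideanSpace ℝ (KSet n k)) :=
  Submodule.span ℝ (containInd k '' {J : Finset (Fin n) | J.card ≤ j})

lemma containInd_mem {n k j : ℕ} {J : Finset (Fin n)} (h : J.card ≤ j) :
    containInd k J ∈ degreeLE n k j :=
  Submodule.subset_span ⟨J, h, rfl⟩

lemma degreeLE_mono {n k i j : ℕ} (h : i ≤ j) : degreeLE n k i ≤ degreeLE n k j :=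
  Submodule.span_mono (Set.image_mono fun _ hJ => le_trans hJ h)

lemma degreeLE_self (n k : ℕ) : degreeLE n k k = ⊤ := by
  rw [eq_top_iff]
  intro f _
  have : f = ∑ A : KSet n k, f A • containInd k A.1 := by
    ext B
    simp only [WithLp.ofLp_sum, WithLp.ofLp_smul, Finset.sum_apply, Pi.smul_apply, smul_eq_mul,
      containInd_apply]
    rw [Finset.sum_eq_single B]
    · simp
    · intro A _ hAB
      have : ¬ A.1 ⊆ B.1 := fun hs =>
        hAB (Subtype.ext (Finset.eq_of_subset_of_card_le hs (by rw [A.2, B.2])))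
      simp [this]
    · simp
  rw [this]
  exact Submodule.sum_mem _ fun A _ => Submodule.smul_mem _ _ (containInd_mem A.2.le)

/-- The number of `k`-sets containing `J` and disjoint from `D`. -/
lemma card_containing_disjoint {n k : ℕ} (J D : Finset (Fin n)) (hJ : J.card ≤ k)
    (hJD : Disjoint J D) :
    (univ.filter fun B : KSet n k => J ⊆ B.1 ∧ Disjoint D B.1).card =
      (n - D.card - J.card).choose (k - J.card) := by
  have hc : (J ∪ D)ᶜ.card = n - D.card - J.card := by
    rw [card_compl, card_union_of_disjoint hJD, Fintype.card_fin]; omega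
  rw [← hc, ← card_powersetCard]
  refine card_bij' (fun B _ => B.1 \ J)
    (fun C hC => ⟨C ∪ J, ?_⟩) ?_ ?_ ?_ ?_
  · rw [mem_powersetCard] at hC
    rw [card_union_of_disjoint, hC.2]
    · omega
    · rw [disjoint_left]
      intro x hx hxJ
      have := hC.1 hx
      simp [hxJ] at this
  · intro B hB
    simp only [mem_filter, mem_univ, true_and] at hB
    rw [mem_powersetCard, card_sdiff_of_subset hB.1, B.2]
    refine ⟨fun x hx => ?_, rfl⟩
    simp only [mem_sdiff] at hx
    simp only [mem_compl, mem_union, not_or]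
    exact ⟨hx.2, fun hxD => disjoint_left.1 hB.2 hxD hx.1⟩
  · intro C hC
    rw [mem_powersetCard] at hC
    simp only [mem_filter, mem_univ, true_and]
    refine ⟨subset_union_right, ?_⟩
    rw [disjoint_union_right]
    refine ⟨?_, hJD.symm⟩
    rw [disjoint_left]
    intro x hx hxC
    have := hC.1 hxC
    simp [hx] at this
  · intro B hB
    simp only [mem_filter, mem_univ, true_and] at hB
    exact Subtype.ext (sdiff_union_of_subset hB.1)
  · intro C hC
    rw [mem_powersetCard] at hC
    simp only [union_sdiff_right, Finset.sdiff_eq_self_iff_disjoint]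
    rw [disjoint_left]
    intro x hx hxJ
    have := hC.1 hx
    simp [hxJ] at this

/-- Inclusion–exclusion over J ∩ A. It shows that the indicator of missing J has degree at most |J|.
-/
lemma sum_powerset_containInd {n k : ℕ} (J : Finset (Fin n)) (A : KSet n k) :
    ∑ I ∈ J.powerset, (-1 : ℝ) ^ I.card * containInd k I A = if Disjoint J A.1 then 1 else 0 := by
  have h1 : ∑ I ∈ J.powerset, (-1 : ℝ) ^ I.card * containInd k I A =
      ∑ I ∈ (J ∩ A.1).powerset, (-1 : ℝ) ^ I.card := by
    simp only [containInd_apply, mul_ite, mul_one, mul_zero]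
    rw [← sum_filter]
    refine sum_congr ?_ fun _ _ => rfl
    ext I
    simp only [mem_filter, mem_powerset, subset_inter_iff]
  have h2 := Finset.sum_powerset_neg_one_pow_card (x := J ∩ A.1)
  rw [h1]
  have h3 : ((∑ I ∈ (J ∩ A.1).powerset, (-1 : ℤ) ^ I.card : ℤ) : ℝ) =
      ∑ I ∈ (J ∩ A.1).powerset, (-1 : ℝ) ^ I.card := by push_cast; rfl
  rw [← h3, h2]
  simp [disjoint_iff_inter_eq_empty]

/-- A set A meeting J has no neighbour containing J, and every A missing J has the same number of
them. The operator is thus triangular in |J|. -/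
lemma kneserOp_containInd {n k : ℕ} (J : Finset (Fin n)) (hJ : J.card ≤ k) :
    kneserOp n k (containInd k J) = ((n - k - J.card).choose (k - J.card) : ℝ) •
      ∑ I ∈ J.powerset, (-1 : ℝ) ^ I.card • containInd k I := by
  ext A
  rw [kneserOp_apply]
  simp only [WithLp.ofLp_sum, WithLp.ofLp_smul, Finset.sum_apply, Pi.smul_apply, smul_eq_mul]
  rw [sum_powerset_containInd]
  simp only [containInd_apply, ← ite_and]
  rw [← sum_filter, sum_const, nsmul_eq_mul, mul_one]
  by_cases h : Disjoint J A.1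
  · have := card_containing_disjoint (k := k) J A.1 hJ h
    rw [A.2] at this
    simp only [and_comm, h, if_true, mul_one] at this ⊢
    rw [this]
  · rw [if_neg h, mul_zero, Nat.cast_eq_zero, card_eq_zero, filter_eq_empty_iff]
    rintro B - ⟨hd, hs⟩
    exact h (disjoint_of_subset_left hs hd.symm)

lemma kneserOp_mem_degreeLE {n k j : ℕ} (hj : j ≤ k) {f : EuclideanSpace ℝ (KSet n k)}
    (hf : f ∈ degreeLE n k j) : kneserOp n k f ∈ degreeLE n k j := by
  have : degreeLE n k j ≤ (degreeLE n k j).comap (kneserOp n k) := by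
    refine Submodule.span_le.2 ?_
    rintro _ ⟨J, hJ, rfl⟩
    simp only [Set.mem_ofPred_eq] at hJ
    simp only [SetLike.mem_coe, Submodule.mem_comap]
    rw [kneserOp_containInd J (hJ.trans hj)]
    exact Submodule.smul_mem _ _ (Submodule.sum_mem _ fun I hI => Submodule.smul_mem _ _
      (containInd_mem ((card_le_card (mem_powerset.1 hI)).trans hJ)))
  exact this hf

/-- In the expansion of the image of `containInd k J` only the term I = J has full degree, so modulo
lower degree the operator is a scalar. -/
lemma kneserOp_sub_smul_mem_degreeLE {n k j : ℕ} (hj : j + 1 ≤ k)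
    {f : EuclideanSpace ℝ (KSet n k)} (hf : f ∈ degreeLE n k (j + 1)) :
    kneserOp n k f - ((-1 : ℝ) ^ (j + 1) * ((n - k - (j + 1)).choose (k - (j + 1)) : ℝ)) • f ∈
      degreeLE n k j := by
  set c : ℝ := (-1 : ℝ) ^ (j + 1) * ((n - k - (j + 1)).choose (k - (j + 1)) : ℝ)
  have : degreeLE n k (j + 1) ≤ (degreeLE n k j).comap (kneserOp n k - c • LinearMap.id) := by
    refine Submodule.span_le.2 ?_
    rintro _ ⟨J, hJ, rfl⟩
    simp only [Set.mem_ofPred_eq] at hJ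
    simp only [SetLike.mem_coe, Submodule.mem_comap, LinearMap.sub_apply, LinearMap.smul_apply,
      LinearMap.id_apply]
    rcases Nat.lt_or_ge J.card (j + 1) with h | h
    · have hm : containInd k J ∈ degreeLE n k j := containInd_mem (by omega)
      exact Submodule.sub_mem _ (kneserOp_mem_degreeLE (by omega) hm)
        (Submodule.smul_mem _ _ hm)
    · have hc : J.card = j + 1 := le_antisymm hJ h
      rw [kneserOp_containInd J (hJ.trans hj), ← Finset.sum_erase_add _ _ (mem_powerset_self J),
        smul_add, hc, smul_smul, mul_comm _ ((-1 : ℝ) ^ (j + 1)), add_sub_cancel_right]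
      refine Submodule.smul_mem _ _ (Submodule.sum_mem _ fun I hI => Submodule.smul_mem _ _
        (containInd_mem ?_))
      rw [mem_erase, mem_powerset] at hI
      have := card_lt_card (hI.2.ssubset_of_ne hI.1)
      omega
  simpa using this hf

/-- The defect g = Kf - cf has degree at most j, and so does Kg. As f is orthogonal to both,
symmetry of K gives ⟨g, g⟩ = ⟨Kg, f⟩ - c⟨g, f⟩ = 0. -/
lemma kneserOp_eq_smul {n k j : ℕ} (hj : j + 1 ≤ k) {f : EuclideanSpace ℝ (KSet n k)}
    (hf : f ∈ degreeLE n k (j + 1)) (hf' : f ∈ (degreeLE n k j)ᗮ) :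
    kneserOp n k f =
      ((-1 : ℝ) ^ (j + 1) * ((n - k - (j + 1)).choose (k - (j + 1)) : ℝ)) • f := by
  have h1 := kneserOp_sub_smul_mem_degreeLE hj hf
  set c : ℝ := (-1 : ℝ) ^ (j + 1) * ((n - k - (j + 1)).choose (k - (j + 1)) : ℝ)
  obtain ⟨g, hg⟩ : ∃ g, g = kneserOp n k f - c • f := ⟨_, rfl⟩
  rw [← hg] at h1
  rw [Submodule.mem_orthogonal] at hf'
  have h2 : ⟪g, g⟫_ℝ = 0 := by
    conv_lhs => rw [hg, inner_sub_right]
    rw [← hg, ← kneserOp_isSymmetric, inner_smul_right, hf' _ h1,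
      hf' _ (kneserOp_mem_degreeLE (by omega) h1)]
    simp
  rw [← sub_eq_zero, ← hg]
  exact inner_self_eq_zero.1 h2

/-- Makes the absolute values of the eigenvalues decrease with the level, so that level two bounds
all higher ones. -/
lemma choose_sub_sub_le (m r i : ℕ) (hi : i ≤ r) (hr : r ≤ m):
    (m - i).choose (r - i) ≤ m.choose r := by
  induction i with
  | zero => simp
  | succ i ih =>
    refine le_trans ?_ (ih (by omega))
    obtain ⟨a, ha⟩ : ∃ a, m - i = a + 1 := ⟨m - i - 1, by omega⟩
    obtain ⟨b, hb⟩ : ∃ b, r - i = b + 1 := ⟨r - i - 1, by omega⟩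
    have h1 : m - (i + 1) = a := by omega
    have h2 : r - (i + 1) = b := by omega
    rw [ha, hb, h1, h2, Nat.choose_succ_succ]
    omega

/-- Functions orthogonal to all functions of degree at most one are contracted by the Kneser
operator down to its third eigenvalue. -/
lemma abs_inner_kneserOp_le {n k : ℕ} (hk : 1 ≤ k) (hn : 2 * k ≤ n) {c : ℝ}
    (hc : 2 ≤ k → ((n - k - 2).choose (k - 2) : ℝ) ≤ c)
    {f : EuclideanSpace ℝ (KSet n k)} (hf : f ∈ (degreeLE n k 1)ᗮ) :
    |⟪f, kneserOp n k f⟫_ℝ| ≤ c * ⟪f, f⟫_ℝ := by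
  suffices H : ∀ j, 1 ≤ j → j ≤ k → ∀ f ∈ degreeLE n k j, f ∈ (degreeLE n k 1)ᗮ →
      |⟪f, kneserOp n k f⟫_ℝ| ≤ c * ⟪f, f⟫_ℝ from
    H k hk le_rfl f (by rw [degreeLE_self]; trivial) hf
  intro j hj
  induction j, hj using Nat.le_induction with
  | base =>
    intro _ f h1 h2
    have : ⟪f, f⟫_ℝ = 0 := (Submodule.mem_orthogonal _ _).1 h2 f h1
    rw [inner_self_eq_zero] at this
    simp [this]
  | succ j hj ih =>
    intro hjk f h1 h2
    -- Peel off the top level: v is an eigenvector orthogonal to u, so the quadratic form has no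
    -- cross terms.
    obtain ⟨u, hu, v, hv, huv⟩ := (degreeLE n k j).exists_add_mem_mem_orthogonal f
    have hv1 : v ∈ degreeLE n k (j + 1) := by
      have : v = f - u := by rw [huv]; abel
      rw [this]
      exact Submodule.sub_mem _ h1 (degreeLE_mono (by omega) hu)
    have hv2 : v ∈ (degreeLE n k 1)ᗮ := Submodule.orthogonal_le (degreeLE_mono hj) hv
    have hu2 : u ∈ (degreeLE n k 1)ᗮ := by
      have : u = f - v := by rw [huv]; abel
      rw [this]
      exact Submodule.sub_mem _ h2 hv2
    have hu3 := ih (by omega) u hu hu2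
    have hKv := kneserOp_eq_smul hjk hv1 hv
    have huv0 : ⟪u, v⟫_ℝ = 0 := (Submodule.mem_orthogonal _ _).1 hv u hu
    have hvu0 : ⟪v, u⟫_ℝ = 0 := by rw [real_inner_comm]; exact huv0
    set a : ℝ := (-1 : ℝ) ^ (j + 1) * ((n - k - (j + 1)).choose (k - (j + 1)) : ℝ)
    have ha : |a| ≤ c := by
      simp only [a, abs_mul, abs_pow, abs_neg, abs_one, one_pow, one_mul, Nat.abs_cast]
      refine le_trans ?_ (hc (by omega))
      have := choose_sub_sub_le (n - k - 2) (k - 2) (j - 1) (by omega) (by omega)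
      have e1 : n - k - 2 - (j - 1) = n - k - (j + 1) := by omega
      have e2 : k - 2 - (j - 1) = k - (j + 1) := by omega
      rw [e1, e2] at this
      exact_mod_cast this
    have e1 : ⟪f, kneserOp n k f⟫_ℝ = ⟪u, kneserOp n k u⟫_ℝ + a * ⟪v, v⟫_ℝ := by
      rw [huv, map_add, hKv]
      simp only [inner_add_left, inner_add_right, inner_smul_right, huv0]
      have : ⟪v, kneserOp n k u⟫_ℝ = 0 := by
        rw [← kneserOp_isSymmetric, hKv, inner_smul_left, hvu0, mul_zero]
      rw [this]; ring
    have e2 : ⟪f, f⟫_ℝ = ⟪u, u⟫_ℝ + ⟪v, v⟫_ℝ := by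
      rw [huv]
      simp only [inner_add_left, inner_add_right, huv0, hvu0]; ring
    rw [e1, e2, mul_add]
    refine (abs_add_le _ _).trans (add_le_add hu3 ?_)
    rw [abs_mul, abs_of_nonneg (real_inner_self_nonneg (x := v))]
    exact mul_le_mul_of_nonneg_right ha real_inner_self_nonneg
end

/-! ### Mean, linear part and higher part of the indicator of a family. -/

section
open Finset
open scoped InnerProductSpace

/-- The number of `k`-subsets of an `n`-set that contain a given `r`-subset. -/
def supCount (n k r : ℕ) : ℕ := if r ≤ k then (n - r).choose (k - r) else 0

lemma supCount_of_le {n k r : ℕ} (h : r ≤ k) : supCount n k r = (n - r).choose (k - r) := if_pos h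

lemma card_filter_subset {n k : ℕ} (J : Finset (Fin n)) :
    (univ.filter fun A : KSet n k => J ⊆ A.1).card = supCount n k J.card := by
  by_cases h : J.card ≤ k
  · have := card_containing_disjoint (k := k) J ∅ h (disjoint_empty_right _)
    simpa [supCount, h] using this
  · rw [supCount, if_neg h, card_eq_zero, filter_eq_empty_iff]
    intro A _ hA
    have := card_le_card hA
    rw [A.2] at this
    exact h this

lemma sum_containInd {n k : ℕ} (J : Finset (Fin n)) :
    ∑ A : KSet n k, containInd k J A = supCount n k J.card := by
  simp only [containInd_apply, ← card_filter_subset (k := k) J]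
  simp

/-- The absorption identity for binomials. Extending `supCount` by zero makes it hold for every r,
so k = 1 needs no separate treatment. -/
lemma supCount_succ {n k r : ℕ} (hn : k ≤ n) :
    ((n : ℝ) - r) * supCount n k (r + 1) = ((k : ℝ) - r) * supCount n k r := by
  rcases lt_trichotomy r k with h | h | h
  · rw [supCount_of_le h.le, supCount_of_le h]
    obtain ⟨a, ha⟩ : ∃ a, n - r = a + 1 := ⟨n - r - 1, by omega⟩
    obtain ⟨b, hb⟩ : ∃ b, k - r = b + 1 := ⟨k - r - 1, by omega⟩
    have h1 : n - (r + 1) = a := by omega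
    have h2 : k - (r + 1) = b := by omega
    rw [h1, h2, ha, hb]
    have h3 : (n : ℝ) - r = a + 1 := by
      rw [← Nat.cast_sub (by omega), ha]; push_cast; ring
    have h4 : (k : ℝ) - r = b + 1 := by
      rw [← Nat.cast_sub (by omega), hb]; push_cast; ring
    rw [h3, h4]
    have := Nat.add_one_mul_choose_eq a b
    have h5 : ((a + 1 : ℕ) : ℝ) * a.choose b = (a + 1).choose (b + 1) * ((b + 1 : ℕ) : ℝ) := by
      exact_mod_cast this
    push_cast at h5
    linarith
  · subst h; simp [supCount]
  · simp [supCount, show ¬ r ≤ k by omega, show ¬ r + 1 ≤ k by omega]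

lemma inner_containInd {n k : ℕ} (I J : Finset (Fin n)) :
    ⟪containInd k I, containInd k J⟫_ℝ = supCount n k (I ∪ J).card := by
  rw [PiLp.inner_apply, ← sum_containInd (k := k) (I ∪ J)]
  refine sum_congr rfl fun A _ => ?_
  simp only [containInd_apply, union_subset_iff]
  by_cases h1 : I ⊆ A.1 <;> by_cases h2 : J ⊆ A.1 <;> simp [h1, h2]

/-- The function `A ↦ ∑ i ∈ A, z i`. -/
noncomputable def linearFun {n : ℕ} (k : ℕ) (z : Fin n → ℝ) : EuclideanSpace ℝ (KSet n k) :=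
  ∑ i, z i • containInd k {i}

lemma linearFun_apply {n k : ℕ} (z : Fin n → ℝ) (A : KSet n k) :
    linearFun k z A = ∑ i, z i * containInd k {i} A := by
  simp [linearFun]

lemma linearFun_mem {n k : ℕ} (z : Fin n → ℝ) : linearFun k z ∈ degreeLE n k 1 :=
  Submodule.sum_mem _ fun _ _ => Submodule.smul_mem _ _ (containInd_mem (by simp))

/-- All off-diagonal inner products are equal, so ∑ z = 0 leaves only the diagonal excess. -/
lemma inner_containInd_singleton_linearFun {n k : ℕ} {z : Fin n → ℝ} (hz : ∑ i, z i = 0)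
    (j : Fin n) :
    ⟪containInd k {j}, linearFun k z⟫_ℝ = z j * (supCount n k 1 - supCount n k 2) := by
  rw [linearFun, inner_sum]
  simp only [inner_smul_right, inner_containInd]
  have : ∀ i, z i * (supCount n k (({j} : Finset (Fin n)) ∪ {i}).card : ℝ) =
      z i * supCount n k 2 + if j = i then z i * (supCount n k 1 - supCount n k 2) else 0 := by
    intro i
    by_cases h : j = i
    · subst h; simp; ring
    · rw [if_neg h]
      have : (({j} : Finset (Fin n)) ∪ {i}).card = 2 := by
        rw [card_union_of_disjoint (by simpa using h)]; simp
      rw [this, add_zero]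
  simp only [this, sum_add_distrib, ← sum_mul, hz]
  simp

lemma inner_one_linearFun {n k : ℕ} {z : Fin n → ℝ} (hz : ∑ i, z i = 0) :
    ⟪containInd k ∅, linearFun k z⟫_ℝ = 0 := by
  rw [linearFun, inner_sum]
  simp only [inner_smul_right, inner_containInd]
  simp [← sum_mul, hz]

lemma inner_linearFun_self {n k : ℕ} {z : Fin n → ℝ} (hz : ∑ i, z i = 0) :
    ⟪linearFun k z, linearFun k z⟫_ℝ =
      (supCount n k 1 - supCount n k 2) * ∑ i, z i ^ 2 := by
  conv_lhs => rw [linearFun, sum_inner]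
  simp only [inner_smul_left]
  rw [← linearFun]
  simp only [inner_containInd_singleton_linearFun hz]
  rw [mul_sum]
  refine sum_congr rfl fun i _ => ?_
  simp; ring

lemma kneserOp_one {n k : ℕ} :
    kneserOp n k (containInd k ∅) = ((n - k).choose k : ℝ) • containInd k ∅ := by
  rw [kneserOp_containInd ∅ (by simp)]
  simp

lemma kneserOp_linearFun {n k : ℕ} (hk : 1 ≤ k) {z : Fin n → ℝ} (hz : ∑ i, z i = 0) :
    kneserOp n k (linearFun k z) = -((n - k - 1).choose (k - 1) : ℝ) • linearFun k z := by
  rw [linearFun, map_sum]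
  have : ∀ i : Fin n, kneserOp n k (z i • containInd k {i}) =
      (z i * ((n - k - 1).choose (k - 1) : ℝ)) • containInd k ∅ +
        (-((n - k - 1).choose (k - 1) : ℝ)) • (z i • containInd k {i}) := by
    intro i
    rw [map_smul, kneserOp_containInd {i} (by simpa using hk)]
    have : ({i} : Finset (Fin n)).powerset = {∅, {i}} := rfl
    rw [this, sum_pair (by simp)]
    simp only [card_empty, card_singleton, pow_zero, one_smul, pow_one, smul_add, smul_smul]
    congr 2
    ring
  simp only [this, sum_add_distrib, ← sum_smul, ← sum_mul, hz, ← smul_sum]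
  simp

/-- The indicator function of a family of `k`-sets. -/
noncomputable def familyInd {n k : ℕ} (F : Finset (KSet n k)) : EuclideanSpace ℝ (KSet n k) :=
  WithLp.toLp 2 fun A => if A ∈ F then 1 else 0

lemma familyInd_apply {n k : ℕ} (F : Finset (KSet n k)) (A : KSet n k) :
    familyInd F A = if A ∈ F then 1 else 0 := rfl

lemma inner_familyInd {n k : ℕ} (F : Finset (KSet n k)) (f : EuclideanSpace ℝ (KSet n k)) :
    ⟪familyInd F, f⟫_ℝ = ∑ A ∈ F, f A := by
  rw [PiLp.inner_apply]
  simp only [familyInd_apply]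
  rw [← sum_filter_add_sum_filter_not univ (fun A => A ∈ F)]
  rw [sum_eq_zero (s := univ.filter fun A => A ∉ F)]
  · simp only [filter_univ_mem, add_zero]
    exact sum_congr rfl fun A hA => by simp [hA]
  · intro A hA
    simp only [mem_filter, mem_univ, true_and] at hA
    simp [hA]

/-- The number of sets in `G` disjoint from `A`. -/
def disjDeg {n k : ℕ} (G : Finset (KSet n k)) (A : KSet n k) : ℕ :=
  (G.filter fun B => Disjoint A.1 B.1).card

lemma inner_familyInd_kneserOp {n k : ℕ} (F G : Finset (KSet n k)) :
    ⟪familyInd F, kneserOp n k (familyInd G)⟫_ℝ = ∑ A ∈ F, (disjDeg G A : ℝ) := by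
  rw [inner_familyInd]
  refine sum_congr rfl fun A _ => ?_
  rw [kneserOp_apply, disjDeg, ← sum_filter]
  simp only [familyInd_apply]
  rw [← sum_filter, filter_filter]
  simp only [sum_const, nsmul_eq_mul, mul_one]
  congr 2
  ext B
  simp [and_comm]

/-- Normalized centered degree of the point `i` in the family `F`. -/
noncomputable def levelOneCoeff {n k : ℕ} (F : Finset (KSet n k)) (i : Fin n) : ℝ :=
  ((F.filter fun A => i ∈ A.1).card : ℝ) / supCount n k 1 - (F.card : ℝ) / n.choose k

lemma sum_card_filter_mem {n k : ℕ} (F : Finset (KSet n k)) :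
    ∑ i, ((F.filter fun A => i ∈ A.1).card : ℝ) = k * F.card := by
  have : ∑ i : Fin n, (F.filter fun A => i ∈ A.1).card = ∑ A ∈ F, k := by
    simp only [card_filter]
    rw [sum_comm]
    refine sum_congr rfl fun A _ => ?_
    simp [A.2]
  have h : ((∑ i : Fin n, (F.filter fun A => i ∈ A.1).card : ℕ) : ℝ) = (∑ A ∈ F, k : ℕ) := by
    rw [this]
  push_cast at h
  rw [h]
  simp [mul_comm]


lemma supCount_zero {n k : ℕ} : supCount n k 0 = n.choose k := by simp [supCount]

lemma supCount_one_pos {n k : ℕ} (hk : 1 ≤ k) (hn : 2 * k ≤ n) : (0 : ℝ) < supCount n k 1 := by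
  rw [supCount_of_le hk]
  exact_mod_cast Nat.choose_pos (by omega)

lemma supCount_one_mul {n k : ℕ} (hn : k ≤ n) :
    (n : ℝ) * supCount n k 1 = k * n.choose k := by
  have := supCount_succ (r := 0) hn
  simpa [supCount_zero] using this

lemma sum_levelOneCoeff {n k : ℕ} (hk : 1 ≤ k) (hn : 2 * k ≤ n) (F : Finset (KSet n k)) :
    ∑ i, levelOneCoeff F i = 0 := by
  simp only [levelOneCoeff, sum_sub_distrib, ← sum_div, sum_card_filter_mem]
  have h1 := supCount_one_pos hk hn
  have h2 : (0 : ℝ) < n.choose k := by exact_mod_cast Nat.choose_pos (by omega)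
  have h3 := supCount_one_mul (n := n) (k := k) (by omega)
  simp only [sum_const, card_univ, Fintype.card_fin, nsmul_eq_mul]
  field_simp
  rw [← h3]; ring

/-- Explains the factor (n-1)/(n-k) below: it compensates for the diagonal excess, turning
`levelOneCoeff` into the coefficients of the orthogonal projection onto level one. -/
lemma supCount_one_sub_two {n k : ℕ} (hk : 1 ≤ k) (hn : 2 * k ≤ n) :
    (supCount n k 1 - supCount n k 2 : ℝ) * (((n : ℝ) - 1) / (n - k)) = supCount n k 1 := by
  have h := supCount_succ (n := n) (k := k) (r := 1) (by omega)
  have hkn : (k : ℝ) < n := by exact_mod_cast (by omega : k < n)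
  have : (n : ℝ) - k ≠ 0 := by linarith
  field_simp
  push_cast at h
  linarith

/-- Decomposition of the indicator function of `F` into its mean, its linear part and a part of
higher degree. -/
lemma level_decomposition {n k : ℕ} (hk : 1 ≤ k) (hn : 2 * k ≤ n) (F : Finset (KSet n k))
    {b : ℝ} (hb : 2 ≤ k → ((n - k - 2).choose (k - 2) : ℝ) ≤ b) (hb0 : 0 ≤ b)
    {g : EuclideanSpace ℝ (KSet n k)}
    (hg : g = linearFun k fun i => ((n : ℝ) - 1) / (n - k) * levelOneCoeff F i) :
    ∑ A ∈ F, g A = ∑ A, g A ^ 2 ∧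
    ∑ A, g A ^ 2 = supCount n k 1 * (((n : ℝ) - 1) / (n - k)) * ∑ i, levelOneCoeff F i ^ 2 ∧
    ∑ A, g A ^ 2 ≤ F.card ∧
    |∑ A ∈ F, (disjDeg F A : ℝ) - ((n - k).choose k * F.card ^ 2 / n.choose k
      - (n - k - 1).choose (k - 1) * ∑ A, g A ^ 2)| ≤ b * F.card := by
  set c : ℝ := ((n : ℝ) - 1) / (n - k)
  set N : ℝ := ((n.choose k : ℕ) : ℝ)
  set L : ℝ := (((n - k - 1).choose (k - 1) : ℕ) : ℝ)
  set lam : ℝ := (((n - k).choose k : ℕ) : ℝ)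
  set α : ℝ := F.card / N with hα
  have hN : 0 < N := Nat.cast_pos.2 (Nat.choose_pos (by omega))
  have hMc : (supCount n k 1 - supCount n k 2 : ℝ) * c = supCount n k 1 :=
    supCount_one_sub_two hk hn
  have hM := supCount_one_pos hk hn
  have hz : ∑ i, c * levelOneCoeff F i = 0 := by
    rw [← mul_sum, sum_levelOneCoeff hk hn, mul_zero]
  have hW : ∑ A, g A ^ 2 = ⟪g, g⟫_ℝ := by
    rw [PiLp.inner_apply]; exact sum_congr rfl fun A _ => by simp [sq]
  set one : EuclideanSpace ℝ (KSet n k) := containInd k ∅ with hone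
  have h11 : ⟪one, one⟫_ℝ = N := by
    rw [inner_containInd]; simp [supCount_zero, N]
  have h1g : ⟪one, g⟫_ℝ = 0 := by rw [hg]; exact inner_one_linearFun hz
  have hg1 : ⟪g, one⟫_ℝ = 0 := by rw [real_inner_comm]; exact h1g
  obtain ⟨f, hf⟩ : ∃ f, f = familyInd F := ⟨_, rfl⟩
  obtain ⟨h, hh⟩ : ∃ h, h = f - α • one - g := ⟨_, rfl⟩
  have hf1 : ⟪f, one⟫_ℝ = F.card := by
    rw [hf, inner_familyInd]; simp [hone, containInd_apply]
  have hff : ⟪f, f⟫_ℝ = F.card := by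
    rw [hf, inner_familyInd]; simp [familyInd_apply]
  have hfi : ∀ i, ⟪containInd k {i}, f⟫_ℝ = ((F.filter fun A => i ∈ A.1).card : ℝ) := by
    intro i
    rw [real_inner_comm, hf, inner_familyInd]; simp [containInd_apply]
  -- It suffices to test against constants and point indicators; the value of α handles the former
  -- and the coefficients of g the latter.
  have hperp : h ∈ (degreeLE n k 1)ᗮ := by
    rw [Submodule.mem_orthogonal]
    intro u hu
    induction hu using Submodule.span_induction with
    | zero => simp
    | add x y _ _ hx hy => rw [inner_add_left, hx, hy, add_zero]
    | smul a x _ hx => rw [inner_smul_left, hx, mul_zero]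
    | mem x hx =>
      obtain ⟨J, hJ, rfl⟩ := hx
      have hJ' : J.card ≤ 1 := hJ
      rw [hh, inner_sub_right, inner_sub_right, inner_smul_right]
      rcases Nat.le_one_iff_eq_zero_or_eq_one.1 hJ' with h0 | h0
      · rw [card_eq_zero] at h0
        subst h0
        rw [← hone, h11, h1g, real_inner_comm, hf1, hα]
        field_simp; ring
      · obtain ⟨i, rfl⟩ := card_eq_one.1 h0
        rw [hfi, hg, inner_containInd_singleton_linearFun hz, hone, inner_containInd]
        simp only [union_empty, card_singleton]
        have e : c * levelOneCoeff F i * (supCount n k 1 - supCount n k 2) =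
            levelOneCoeff F i * supCount n k 1 := by
          linear_combination levelOneCoeff F i * hMc
        rw [e, levelOneCoeff, sub_mul, div_mul_cancel₀ _ hM.ne']
        ring
  rw [Submodule.mem_orthogonal] at hperp
  have hone_mem : one ∈ degreeLE n k 1 := containInd_mem (by simp)
  have hg_mem : g ∈ degreeLE n k 1 := by rw [hg]; exact linearFun_mem _
  have h1h : ⟪one, h⟫_ℝ = 0 := hperp _ hone_mem
  have hgh : ⟪g, h⟫_ℝ = 0 := hperp _ hg_mem
  have hh1 : ⟪h, one⟫_ℝ = 0 := by rw [real_inner_comm]; exact h1h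
  have hhg : ⟪h, g⟫_ℝ = 0 := by rw [real_inner_comm]; exact hgh
  have hfd : f = α • one + g + h := by rw [hh]; abel
  have hfg : ⟪f, g⟫_ℝ = ⟪g, g⟫_ℝ := by
    rw [hfd]; simp only [inner_add_left, inner_smul_left, h1g, hhg]; simp
  have hff2 : ⟪f, f⟫_ℝ = α ^ 2 * N + ⟪g, g⟫_ℝ + ⟪h, h⟫_ℝ := by
    rw [hfd]
    simp only [inner_add_left, inner_add_right, inner_smul_left, inner_smul_right, h1g, hhg, hg1,
      hgh, h1h, hh1, h11]
    simp; ring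
  have hK1 : kneserOp n k one = lam • one := kneserOp_one
  have hKg : kneserOp n k g = (-L) • g := by rw [hg]; exact kneserOp_linearFun hk hz
  have hKh1 : ⟪one, kneserOp n k h⟫_ℝ = 0 := by
    rw [← kneserOp_isSymmetric, hK1, inner_smul_left, h1h, mul_zero]
  have hKhg : ⟪g, kneserOp n k h⟫_ℝ = 0 := by
    rw [← kneserOp_isSymmetric, hKg, inner_smul_left, hgh, mul_zero]
  have hfKf : ⟪f, kneserOp n k f⟫_ℝ =
      lam * α ^ 2 * N - L * ⟪g, g⟫_ℝ + ⟪h, kneserOp n k h⟫_ℝ := by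
    rw [hfd, map_add, map_add, map_smul, hK1, hKg]
    simp only [inner_add_left, inner_add_right, inner_smul_left, inner_smul_right, h1g, hhg, hg1,
      hh1, h11, hKh1, hKhg, conj_trivial]
    ring
  have hh0 : 0 ≤ ⟪h, h⟫_ℝ := real_inner_self_nonneg
  have hg0 : 0 ≤ ⟪g, g⟫_ℝ := real_inner_self_nonneg
  have hα0 : 0 ≤ α ^ 2 * N := mul_nonneg (sq_nonneg _) hN.le
  refine ⟨?_, ?_, ?_, ?_⟩
  · rw [hW, ← hfg, hf, inner_familyInd]
  · rw [hW, hg, inner_linearFun_self hz]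
    simp only [mul_pow, ← mul_sum]
    linear_combination c * (∑ i, levelOneCoeff F i ^ 2) * hMc
  · rw [hW]; linarith
  · have key := abs_inner_kneserOp_le hk hn hb ((Submodule.mem_orthogonal _ _).2 hperp)
    rw [← inner_familyInd_kneserOp, ← hf, hfKf, hW]
    have e : lam * α ^ 2 * N - L * ⟪g, g⟫_ℝ + ⟪h, kneserOp n k h⟫_ℝ -
        (lam * F.card ^ 2 / N - L * ⟪g, g⟫_ℝ) = ⟪h, kneserOp n k h⟫_ℝ := by
      rw [hα]; field_simp; ring
    rw [e]
    refine key.trans (mul_le_mul_of_nonneg_left ?_ hb0)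
    linarith
end

/-! ### Fourth moment of a linear function. -/

section
open Finset
open scoped InnerProductSpace

/-- The cardinality depends only on which indices coincide; the coefficients come from Möbius
inversion on the partitions of four indices. -/
lemma apply_card_quadruple {n : ℕ} (q : ℕ → ℝ) (i j l m : Fin n) :
    q ({i, j, l, m} : Finset (Fin n)).card = q 4
      + (q 3 - q 4) * ((if i = j then 1 else 0) + (if i = l then 1 else 0)
        + (if i = m then 1 else 0) + (if j = l then 1 else 0) + (if j = m then 1 else 0)
        + (if l = m then 1 else 0))
      + (q 2 - 3 * q 3 + 2 * q 4) * ((if i = j then 1 else 0) * (if i = l then 1 else 0)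
        + (if i = j then 1 else 0) * (if i = m then 1 else 0)
        + (if i = l then 1 else 0) * (if i = m then 1 else 0)
        + (if j = l then 1 else 0) * (if j = m then 1 else 0))
      + (q 2 - 2 * q 3 + q 4) * ((if i = j then 1 else 0) * (if l = m then 1 else 0)
        + (if i = l then 1 else 0) * (if j = m then 1 else 0)
        + (if i = m then 1 else 0) * (if j = l then 1 else 0))
      + (q 1 - 7 * q 2 + 12 * q 3 - 6 * q 4) *
        ((if i = j then 1 else 0) * (if i = l then 1 else 0) * (if i = m then 1 else 0)) := by
  by_cases h1 : i = j
  · subst h1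
    by_cases h2 : i = l
    · subst h2
      by_cases h3 : i = m
      · subst h3; simp; ring
      · simp [h3]; ring
    · by_cases h3 : i = m
      · subst h3; simp [h2, Ne.symm h2]; ring
      · by_cases h4 : l = m
        · subst h4; simp [h2]; ring
        · simp [h2, h3, h4]
  · by_cases h2 : i = l
    · subst h2
      by_cases h3 : i = m
      · subst h3; simp [h1, Ne.symm h1]; ring
      · by_cases h4 : j = m
        · subst h4; simp [h1, Ne.symm h1]; ring
        · have : ({i, j, i, m} : Finset (Fin n)) = {i, j, m} := by ext; simp; tauto
          simp [this, h1, h3, h4, Ne.symm h1]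
    · by_cases h3 : i = m
      · subst h3
        by_cases h4 : j = l
        · subst h4; simp [h1, Ne.symm h1]; ring
        · have : ({i, j, l, i} : Finset (Fin n)) = {i, j, l} := by ext; simp; tauto
          simp [this, h1, h2, h4, Ne.symm h1, Ne.symm h2]
      · by_cases h4 : j = l
        · subst h4
          by_cases h5 : j = m
          · subst h5; simp [h1]; ring
          · simp [h1, h3, h5]
        · by_cases h5 : j = m
          · subst h5
            have : ({i, j, l, j} : Finset (Fin n)) = {i, j, l} := by ext; simp; tauto
            simp [h1, h2, h4, Ne.symm h4]
          · by_cases h6 : l = m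
            · subst h6; simp [h1, h2, h4]
            · simp [h1, h2, h3, h4, h5, h6]

/-- An index left free sums to zero, so only the three pairings and the total coincidence survive.
-/
lemma sum_mul_apply_card_quadruple {n : ℕ} (q : ℕ → ℝ) {z : Fin n → ℝ} (hz : ∑ i, z i = 0) :
    ∑ i, ∑ j, ∑ l, ∑ m, z i * z j * z l * z m * q ({i, j, l, m} : Finset (Fin n)).card =
      3 * (q 2 - 2 * q 3 + q 4) * (∑ i, z i ^ 2) ^ 2
        + (q 1 - 7 * q 2 + 12 * q 3 - 6 * q 4) * ∑ i, z i ^ 4 := by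
  set S2 := ∑ i, z i ^ 2 with hS2
  have hm : ∀ i j l : Fin n, ∑ m, z i * z j * z l * z m *
      q ({i, j, l, m} : Finset (Fin n)).card =
      z i * z j * z l * ((q 3 - q 4) * (z i + z j + z l)
        + (q 2 - 3 * q 3 + 2 * q 4) * ((if i = j then 1 else 0) * z i
          + (if i = l then 1 else 0) * z i + (if j = l then 1 else 0) * z j)
        + (q 2 - 2 * q 3 + q 4) * ((if i = j then 1 else 0) * z l + (if i = l then 1 else 0) * z j
          + (if j = l then 1 else 0) * z i)
        + (q 1 - 7 * q 2 + 12 * q 3 - 6 * q 4) *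
          ((if i = j then 1 else 0) * (if i = l then 1 else 0) * z i)) := by
    intro i j l
    have e : ∀ m, z i * z j * z l * z m * q ({i, j, l, m} : Finset (Fin n)).card =
      z m * (z i * z j * z l * (q 4 + (q 3 - q 4) * ((if i = j then 1 else 0)
          + (if i = l then 1 else 0) + (if j = l then 1 else 0))
          + (q 2 - 3 * q 3 + 2 * q 4) * ((if i = j then 1 else 0) * (if i = l then 1 else 0))))
      + (if i = m then z m else 0) * (z i * z j * z l * ((q 3 - q 4)
          + (q 2 - 3 * q 3 + 2 * q 4) * ((if i = j then 1 else 0) + (if i = l then 1 else 0))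
          + (q 2 - 2 * q 3 + q 4) * (if j = l then 1 else 0)
          + (q 1 - 7 * q 2 + 12 * q 3 - 6 * q 4) *
            ((if i = j then 1 else 0) * (if i = l then 1 else 0))))
      + (if j = m then z m else 0) * (z i * z j * z l * ((q 3 - q 4)
          + (q 2 - 3 * q 3 + 2 * q 4) * (if j = l then 1 else 0)
          + (q 2 - 2 * q 3 + q 4) * (if i = l then 1 else 0)))
      + (if l = m then z m else 0) * (z i * z j * z l * ((q 3 - q 4)
          + (q 2 - 2 * q 3 + q 4) * (if i = j then 1 else 0))) := by
      intro m
      have h : ∀ a : Fin n, (if a = m then z m else 0) = z m * (if a = m then 1 else 0) := by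
        intro a; simp
      rw [apply_card_quadruple q, h, h, h]
      ring
    simp only [e, sum_add_distrib, ← sum_mul, hz, sum_ite_eq, mem_univ, if_true]
    ring
  have hl : ∀ i j : Fin n, ∑ l, ∑ m, z i * z j * z l * z m *
      q ({i, j, l, m} : Finset (Fin n)).card =
      z i * z j * ((q 3 - q 4) * S2 + (q 2 - 3 * q 3 + 2 * q 4) * (z i ^ 2 + z j ^ 2)
        + (q 2 - 2 * q 3 + q 4) * ((if i = j then 1 else 0) * S2 + 2 * z i * z j)
        + (q 1 - 7 * q 2 + 12 * q 3 - 6 * q 4) * ((if i = j then 1 else 0) * z i ^ 2)) := by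
    intro i j
    simp only [hm]
    have e : ∀ l, z i * z j * z l * ((q 3 - q 4) * (z i + z j + z l)
        + (q 2 - 3 * q 3 + 2 * q 4) * ((if i = j then 1 else 0) * z i
          + (if i = l then 1 else 0) * z i + (if j = l then 1 else 0) * z j)
        + (q 2 - 2 * q 3 + q 4) * ((if i = j then 1 else 0) * z l + (if i = l then 1 else 0) * z j
          + (if j = l then 1 else 0) * z i)
        + (q 1 - 7 * q 2 + 12 * q 3 - 6 * q 4) *
          ((if i = j then 1 else 0) * (if i = l then 1 else 0) * z i)) =
      z l * (z i * z j * ((q 3 - q 4) * (z i + z j)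
          + (q 2 - 3 * q 3 + 2 * q 4) * ((if i = j then 1 else 0) * z i)))
      + z l ^ 2 * (z i * z j * ((q 3 - q 4)
          + (q 2 - 2 * q 3 + q 4) * (if i = j then 1 else 0)))
      + (if i = l then z l else 0) * (z i * z j * ((q 2 - 3 * q 3 + 2 * q 4) * z i
          + (q 2 - 2 * q 3 + q 4) * z j
          + (q 1 - 7 * q 2 + 12 * q 3 - 6 * q 4) * ((if i = j then 1 else 0) * z i)))
      + (if j = l then z l else 0) * (z i * z j * ((q 2 - 3 * q 3 + 2 * q 4) * z j
          + (q 2 - 2 * q 3 + q 4) * z i)) := by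
      intro l
      have h : ∀ a : Fin n, (if a = l then z l else 0) = z l * (if a = l then 1 else 0) := by
        intro a; simp
      rw [h, h]
      ring
    simp only [e, sum_add_distrib, ← sum_mul, hz, sum_ite_eq, mem_univ, if_true]
    rw [← hS2]
    ring
  have hj : ∀ i : Fin n, ∑ j, ∑ l, ∑ m, z i * z j * z l * z m *
      q ({i, j, l, m} : Finset (Fin n)).card =
      z i * ((q 2 - 3 * q 3 + 2 * q 4) * (∑ j, z j ^ 3))
        + 3 * (q 2 - 2 * q 3 + q 4) * S2 * z i ^ 2
        + (q 1 - 7 * q 2 + 12 * q 3 - 6 * q 4) * z i ^ 4 := by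
    intro i
    simp only [hl]
    have e : ∀ j, z i * z j * ((q 3 - q 4) * S2 + (q 2 - 3 * q 3 + 2 * q 4) * (z i ^ 2 + z j ^ 2)
        + (q 2 - 2 * q 3 + q 4) * ((if i = j then 1 else 0) * S2 + 2 * z i * z j)
        + (q 1 - 7 * q 2 + 12 * q 3 - 6 * q 4) * ((if i = j then 1 else 0) * z i ^ 2)) =
      z j * (z i * ((q 3 - q 4) * S2 + (q 2 - 3 * q 3 + 2 * q 4) * z i ^ 2))
      + z j ^ 2 * (2 * (q 2 - 2 * q 3 + q 4) * z i ^ 2)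
      + z j ^ 3 * (z i * (q 2 - 3 * q 3 + 2 * q 4))
      + (if i = j then z j else 0) * (z i * ((q 2 - 2 * q 3 + q 4) * S2
        + (q 1 - 7 * q 2 + 12 * q 3 - 6 * q 4) * z i ^ 2)) := by
      intro j
      have h : ∀ a : Fin n, (if a = j then z j else 0) = z j * (if a = j then 1 else 0) := by
        intro a; simp
      rw [h]
      ring
    simp only [e, sum_add_distrib, ← sum_mul, hz, sum_ite_eq, mem_univ, if_true]
    rw [← hS2]
    ring
  simp only [hj, sum_add_distrib, ← sum_mul, ← mul_sum, hz]
  rw [← hS2]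
  ring

lemma supCount_antitone {n k r : ℕ} (hn : k ≤ n) (hr : r < n) :
    (supCount n k (r + 1) : ℝ) * n ≤ k * supCount n k r := by
  have h := supCount_succ (r := r) hn
  have hr' : (0 : ℝ) < n - r := by rw [sub_pos]; exact_mod_cast hr
  have hkn : (k : ℝ) ≤ n := by exact_mod_cast hn
  have h0 : (0 : ℝ) ≤ supCount n k r := by positivity
  have : 0 ≤ ((n : ℝ) - k) * r * supCount n k r := by
    have : (0 : ℝ) ≤ n - k := by linarith
    positivity
  refine le_of_mul_le_mul_left ?_ hr'
  nlinarith

/-- Expand the fourth power into indicators of at most four points. Since 4k ≤ n, the counts q1,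
..., q4 drop fast enough that the lower-order corrections have a favourable sign, and q2 ≤ q1²/N. -/
lemma sum_linearFun_pow_four_le {n k : ℕ} (hk : 1 ≤ k) (hn : 4 * k ≤ n) {z : Fin n → ℝ}
    (hz : ∑ i, z i = 0) :
    ∑ A : KSet n k, linearFun k z A ^ 4 ≤ supCount n k 1 * ∑ i, z i ^ 4
      + 3 * (supCount n k 1 ^ 2 / n.choose k) * (∑ i, z i ^ 2) ^ 2 := by
  have e1 : ∑ A : KSet n k, linearFun k z A ^ 4 = ∑ i, ∑ j, ∑ l, ∑ m,
      z i * z j * z l * z m * supCount n k ({i, j, l, m} : Finset (Fin n)).card := by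
    have : ∀ A : KSet n k, linearFun k z A ^ 4 = ∑ i, ∑ j, ∑ l, ∑ m,
        z i * z j * z l * z m * containInd k {i, j, l, m} A := by
      intro A
      rw [linearFun_apply, pow_succ, pow_succ, pow_succ, pow_one, sum_mul_sum, sum_mul, sum_mul]
      refine sum_congr rfl fun i _ => ?_
      rw [sum_mul, sum_mul]
      refine sum_congr rfl fun j _ => ?_
      rw [mul_assoc, sum_mul_sum, mul_sum]
      refine sum_congr rfl fun l _ => ?_
      rw [mul_sum]
      refine sum_congr rfl fun m _ => ?_
      have : containInd k {i, j, l, m} A = containInd k {i} A * containInd k {j} A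
          * containInd k {l} A * containInd k {m} A := by
        simp only [containInd_apply, insert_subset_iff, singleton_subset_iff]
        by_cases h1 : i ∈ A.1 <;> by_cases h2 : j ∈ A.1 <;> by_cases h3 : l ∈ A.1 <;>
          by_cases h4 : m ∈ A.1 <;> simp [h1, h2, h3, h4]
      rw [this]; ring
    simp only [this]
    rw [sum_comm]
    refine sum_congr rfl fun i _ => ?_
    rw [sum_comm]
    refine sum_congr rfl fun j _ => ?_
    rw [sum_comm]
    refine sum_congr rfl fun l _ => ?_
    rw [sum_comm]
    refine sum_congr rfl fun m _ => ?_
    rw [← mul_sum, sum_containInd]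
  rw [e1, sum_mul_apply_card_quadruple (fun r => (supCount n k r : ℝ)) hz]
  have hn0 : (0 : ℝ) < n := by exact_mod_cast (by omega : 0 < n)
  have hk4 : (4 : ℝ) * k ≤ n := by exact_mod_cast hn
  have hN : (0 : ℝ) < n.choose k := Nat.cast_pos.2 (Nat.choose_pos (by omega))
  have a2 := supCount_antitone (n := n) (k := k) (r := 1) (by omega) (by omega)
  have a3 := supCount_antitone (n := n) (k := k) (r := 2) (by omega) (by omega)
  have a4 := supCount_antitone (n := n) (k := k) (r := 3) (by omega) (by omega)
  have h1 := supCount_one_mul (n := n) (k := k) (by omega)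
  norm_num at a2 a3 a4
  set q1 : ℝ := (supCount n k 1 : ℝ)
  set q2 : ℝ := (supCount n k 2 : ℝ)
  set q3 : ℝ := (supCount n k 3 : ℝ)
  set q4 : ℝ := (supCount n k 4 : ℝ)
  set N : ℝ := ((n.choose k : ℕ) : ℝ)
  have p2 : 0 ≤ q2 := by positivity
  have p3 : 0 ≤ q3 := by positivity
  have p4 : 0 ≤ q4 := by positivity
  have b3 : 4 * q3 ≤ q2 := by
    refine le_of_mul_le_mul_left ?_ hn0
    nlinarith
  have b4 : 4 * q4 ≤ q3 := by
    refine le_of_mul_le_mul_left ?_ hn0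
    nlinarith
  have c2 : q2 ≤ q1 ^ 2 / N := by
    rw [le_div_iff₀ hN]
    refine le_of_mul_le_mul_left ?_ hn0
    have h2 := mul_le_mul_of_nonneg_right a2 hN.le
    have h3 : n * q1 * q1 = k * N * q1 := by rw [h1]
    linarith
  have s2 : 0 ≤ (∑ i, z i ^ 2) ^ 2 := by positivity
  have s4 : 0 ≤ ∑ i, z i ^ 4 := sum_nonneg fun i _ => by positivity
  have t1 : (q2 - 2 * q3 + q4) * (∑ i, z i ^ 2) ^ 2 ≤ q1 ^ 2 / N * (∑ i, z i ^ 2) ^ 2 :=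
    mul_le_mul_of_nonneg_right (by linarith) s2
  have t2 : (q1 - 7 * q2 + 12 * q3 - 6 * q4) * ∑ i, z i ^ 4 ≤ q1 * ∑ i, z i ^ 4 :=
    mul_le_mul_of_nonneg_right (by linarith) s4
  linarith
end

/-! ### Binomial bounds, unions of stars and the numerical core. -/

section
open Finset

lemma choose_sub_choose_sub_le {m k s : ℕ} (hk : 1 ≤ k) (hs : s + 1 ≤ m) :
    ((m - 1).choose (k - 1) : ℝ) - s * supCount m k 2 ≤ ((m - s - 1).choose (k - 1) : ℕ) := by
  induction s with
  | zero => simp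
  | succ s ih =>
    have ih' := ih (by omega)
    have key : (m - s - 1).choose (k - 1) ≤ (m - (s + 1) - 1).choose (k - 1) + supCount m k 2 := by
      obtain ⟨a, ha⟩ : ∃ a, m - s - 1 = a + 1 := ⟨m - s - 2, by omega⟩
      have h1 : m - (s + 1) - 1 = a := by omega
      rw [ha, h1]
      rcases Nat.lt_or_ge k 2 with h | h
      · have : k - 1 = 0 := by omega
        simp [this]
      · obtain ⟨b, hb⟩ : ∃ b, k - 1 = b + 1 := ⟨k - 2, by omega⟩
        rw [hb, Nat.choose_succ_succ, supCount_of_le h]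
        have h3 : k - 2 = b := by omega
        have : a.choose b ≤ (m - 2).choose b := Nat.choose_le_choose _ (by omega)
        rw [h3]
        simp only [Nat.succ_eq_add_one]
        omega
    have key' : ((m - s - 1).choose (k - 1) : ℝ) ≤
        ((m - (s + 1) - 1).choose (k - 1) : ℕ) + supCount m k 2 := by exact_mod_cast key
    push_cast at ih' ⊢
    linarith

lemma choose_sub_sub_choose_succ {m k s : ℕ} (hk : 1 ≤ k) (hs : s + 1 ≤ m) :
    (m - s).choose k = (m - s - 1).choose (k - 1) + (m - (s + 1)).choose k := by
  obtain ⟨a, ha⟩ : ∃ a, m - s = a + 1 := ⟨m - s - 1, by omega⟩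
  obtain ⟨b, rfl⟩ : ∃ b, k = b + 1 := ⟨k - 1, by omega⟩
  have h1 : m - (s + 1) = a := by omega
  rw [ha, h1, Nat.choose_succ_succ]
  simp

/-- Bonferroni bounds for the number of `k`-subsets of an `m`-set meeting a given `s`-set. -/
lemma choose_sub_choose_bounds {m k s : ℕ} (hk : 1 ≤ k) (hs : s ≤ m) :
    (s : ℝ) * supCount m k 1 - s * (s - 1) / 2 * supCount m k 2 ≤
      (m.choose k : ℝ) - ((m - s).choose k : ℕ) ∧
    (m.choose k : ℝ) - ((m - s).choose k : ℕ) ≤ s * supCount m k 1 := by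
  rw [supCount_of_le hk]
  induction s with
  | zero => simp
  | succ s ih =>
    obtain ⟨ih1, ih2⟩ := ih (by omega)
    have h1 := choose_sub_choose_sub_le hk hs
    have h2 : ((m - s).choose k : ℝ) =
        ((m - s - 1).choose (k - 1) : ℕ) + ((m - (s + 1)).choose k : ℕ) := by
      exact_mod_cast choose_sub_sub_choose_succ hk hs
    have h3 : ((m - s - 1).choose (k - 1) : ℝ) ≤ ((m - 1).choose (k - 1) : ℕ) := by
      exact_mod_cast Nat.choose_le_choose _ (by omega)
    push_cast at *
    constructor
    · linarith
    · linarith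

lemma card_filter_disjoint {n k : ℕ} (D : Finset (Fin n)) :
    (univ.filter fun B : KSet n k => Disjoint D B.1).card = (n - D.card).choose k := by
  have := card_containing_disjoint (k := k) ∅ D (by simp) (disjoint_empty_left _)
  simpa using this

lemma mem_kneserStar {n k : ℕ} {i : Fin n} {A : KSet n k} : A ∈ kneserStar n k i ↔ i ∈ A.1 := by
  simp [kneserStar]

lemma mem_biUnion_kneserStar {n k : ℕ} {S : Finset (Fin n)} {A : KSet n k} :
    A ∈ S.biUnion (kneserStar n k) ↔ ¬ Disjoint S A.1 := by
  simp [mem_kneserStar, not_disjoint_iff]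

lemma card_biUnion_kneserStar {n k : ℕ} (S : Finset (Fin n)) :
    (S.biUnion (kneserStar n k)).card + (n - S.card).choose k = n.choose k := by
  have h1 : S.biUnion (kneserStar n k) = univ.filter fun B : KSet n k => ¬ Disjoint S B.1 := by
    ext A; rw [mem_biUnion_kneserStar]; simp
  have h2 := card_filter_add_card_filter_not (s := (univ : Finset (KSet n k)))
    (fun B => Disjoint S B.1)
  rw [card_filter_disjoint] at h2
  have h3 : (univ : Finset (KSet n k)).card = n.choose k := by simp
  rw [h1]; omega

lemma disjDeg_biUnion_kneserStar {n k : ℕ} (S : Finset (Fin n)) (A : KSet n k) :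
    disjDeg (S.biUnion (kneserStar n k)) A + (n - (A.1 ∪ S).card).choose k = (n - k).choose k := by
  have h1 : disjDeg (S.biUnion (kneserStar n k)) A =
      ((univ.filter fun B : KSet n k => Disjoint A.1 B.1).filter
        fun B => ¬ Disjoint S B.1).card := by
    rw [disjDeg]; congr 1; ext B
    simp only [mem_filter, mem_biUnion_kneserStar, mem_univ, true_and]; tauto
  have h2 := card_filter_add_card_filter_not
    (s := univ.filter fun B : KSet n k => Disjoint A.1 B.1) (fun B => Disjoint S B.1)
  have h3 : ((univ.filter fun B : KSet n k => Disjoint A.1 B.1).filter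
      fun B => Disjoint S B.1) = univ.filter fun B : KSet n k => Disjoint (A.1 ∪ S) B.1 := by
    ext B; simp
  rw [h3, card_filter_disjoint, card_filter_disjoint, A.2] at h2
  rw [h1]; omega

/-- If all `y i` lie in `[-1, 1]`, `∑ y²` is at most `s` and `∑ y⁴` is almost `s`, then exactly `s`
of the squares are large. -/
lemma exists_card_eq_of_sum_pow {ι : Type*} [Fintype ι] {y : ι → ℝ} {s : ℕ}
    (hy : ∀ i, y i ^ 2 ≤ 1) (h2 : ∑ i, y i ^ 2 ≤ s) (h4 : (s : ℝ) - 1 / 500 ≤ ∑ i, y i ^ 4) :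
    ∃ S : Finset ι, S.card = s ∧ (∀ i ∈ S, 1 / 2 ≤ y i ^ 2) ∧ ∑ i ∈ S, (1 - y i ^ 2) ≤ 1 / 250 := by
  classical
  set S := univ.filter fun i => 1 / 2 ≤ y i ^ 2 with hS
  set T := univ.filter fun i => ¬ 1 / 2 ≤ y i ^ 2 with hT
  have split : ∀ f : ι → ℝ, ∑ i, f i = ∑ i ∈ S, f i + ∑ i ∈ T, f i := fun f =>
    (sum_filter_add_sum_filter_not _ _ _).symm
  -- A small total of y²(1 - y²) puts each square near 0 or 1. Cutting at 1/2 costs a factor 2,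
  -- whence 1/250, and |S| is within less than 1 of s.
  have htot : ∑ i, y i ^ 2 * (1 - y i ^ 2) ≤ 1 / 500 := by
    have : ∀ i, y i ^ 2 * (1 - y i ^ 2) = y i ^ 2 - y i ^ 4 := fun i => by ring
    simp only [this, sum_sub_distrib]
    linarith
  have h0 : ∀ i, 0 ≤ y i ^ 2 * (1 - y i ^ 2) := fun i =>
    mul_nonneg (sq_nonneg _) (by linarith [hy i])
  have hSnn : 0 ≤ ∑ i ∈ S, y i ^ 2 * (1 - y i ^ 2) := sum_nonneg fun i _ => h0 i
  have hTnn : 0 ≤ ∑ i ∈ T, y i ^ 2 * (1 - y i ^ 2) := sum_nonneg fun i _ => h0 i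
  rw [split] at htot
  have a1 : ∑ i ∈ S, (1 - y i ^ 2) ≤ 2 * ∑ i ∈ S, y i ^ 2 * (1 - y i ^ 2) := by
    rw [mul_sum]
    refine sum_le_sum fun i hi => ?_
    have := (mem_filter.1 hi).2
    nlinarith [hy i]
  have a2 : ∑ i ∈ T, y i ^ 2 ≤ 2 * ∑ i ∈ T, y i ^ 2 * (1 - y i ^ 2) := by
    rw [mul_sum]
    refine sum_le_sum fun i hi => ?_
    have := (mem_filter.1 hi).2
    nlinarith [hy i, sq_nonneg (y i)]
  have a3 : ∑ i ∈ S, (1 - y i ^ 2) = S.card - ∑ i ∈ S, y i ^ 2 := by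
    simp
  have a4 : ∑ i, y i ^ 4 ≤ ∑ i, y i ^ 2 := sum_le_sum fun i _ => by
    nlinarith [h0 i]
  have a5 := split fun i => y i ^ 2
  have a6 : 0 ≤ ∑ i ∈ T, y i ^ 2 := sum_nonneg fun i _ => sq_nonneg _
  have a7 : 0 ≤ ∑ i ∈ S, (1 - y i ^ 2) := sum_nonneg fun i _ => by linarith [hy i]
  refine ⟨S, ?_, fun i hi => (mem_filter.1 hi).2, by linarith⟩
  have b1 : (S.card : ℝ) < s + 1 := by linarith
  have b2 : (s : ℝ) < S.card + 1 := by linarith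
  have b1' : S.card < s + 1 := by exact_mod_cast b1
  have b2' : s < S.card + 1 := by exact_mod_cast b2
  omega

/-- Hölder, as Cauchy–Schwarz twice. It is applied to the linear part g, for which the sum over F
equals ‖g‖². -/
lemma sum_pow_four_le {ι : Type*} (F : Finset ι) (g : ι → ℝ) :
    (∑ A ∈ F, g A) ^ 4 ≤ (F.card : ℝ) ^ 3 * ∑ A ∈ F, g A ^ 4 := by
  have h1 := sq_sum_le_card_mul_sum_sq (s := F) (f := g)
  have h2 := sq_sum_le_card_mul_sum_sq (s := F) (f := fun A => g A ^ 2)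
  simp only [← pow_mul] at h2
  norm_num at h2
  calc (∑ A ∈ F, g A) ^ 4 = ((∑ A ∈ F, g A) ^ 2) ^ 2 := by ring
    _ ≤ ((F.card : ℝ) * ∑ A ∈ F, g A ^ 2) ^ 2 := pow_le_pow_left₀ (sq_nonneg _) h1 2
    _ = (F.card : ℝ) ^ 2 * (∑ A ∈ F, g A ^ 2) ^ 2 := by ring
    _ ≤ (F.card : ℝ) ^ 2 * (F.card * ∑ A ∈ F, g A ^ 4) :=
        mul_le_mul_of_nonneg_left h2 (by positivity)
    _ = _ := by ring

/-- The numerical core of the stability argument, in normalized quantities. -/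
lemma pow_four_lower_bound {s p δ w φ c Y : ℝ} (hs : 1 ≤ s) (hp : 0 ≤ p)
    (hsp : 10000 * (s ^ 5 * p) ≤ 1) (hδ : 0 ≤ δ) (hsδ : 10000 * (s * δ) ≤ 1)
    (hφ : φ ≤ s) (hφ' : s - s * (s - 1) / 2 * p ≤ φ)
    (hw1 : w ≤ 1) (hw0 : 0 ≤ w) (hw : (1 - p) * φ - 1.01 * p - (s - 1 + δ) ≤ w)
    (hc1 : 1 ≤ c) (hc : c * (1 - p) ≤ 1)
    (hY : w ^ 4 * φ ≤ c ^ 4 * Y + 3 * c ^ 2 * w ^ 2 * φ ^ 2 * p) :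
    s - 1 / 500 ≤ Y := by
  have e2 : s ≤ s ^ 2 := by nlinarith
  have e3 : s ^ 2 ≤ s ^ 3 := by nlinarith
  have e5 : s ^ 3 ≤ s ^ 5 := by
    have : (1 : ℝ) ≤ s ^ 2 := by nlinarith
    nlinarith [pow_pos (by linarith : 0 < s) 3]
  have f5 : s ^ 3 * p ≤ s ^ 5 * p := mul_le_mul_of_nonneg_right e5 hp
  have f3 : s ^ 2 * p ≤ s ^ 3 * p := mul_le_mul_of_nonneg_right e3 hp
  have f2 : s * p ≤ s ^ 2 * p := mul_le_mul_of_nonneg_right e2 hp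
  have f1 : p ≤ s * p := by nlinarith
  have d1 : δ ≤ s * δ := by nlinarith
  have hφ0 : s - 1 / 2 * (s ^ 2 * p) + 1 / 2 * (s * p) ≤ φ := by linarith
  have hφpos : 0 < φ := by linarith
  have hw' : 1 - (2.01 * (s ^ 2 * p) + δ) ≤ w := by
    have : p * φ ≤ p * s := mul_le_mul_of_nonneg_left hφ hp
    nlinarith
  set η := 2.01 * (s ^ 2 * p) + δ with hη
  have hη0 : 0 ≤ η := by positivity
  have hη1 : η ≤ 1 := by linarith
  have hw2 : 1 - 2 * η ≤ w ^ 2 := by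
    have := pow_le_pow_left₀ (sub_nonneg.2 hη1) hw' 2
    linarith [sq_nonneg η, (by ring : (1 - η) ^ 2 = 1 - 2 * η + η ^ 2)]
  have hw4 : 1 - 4 * η ≤ w ^ 4 := by
    have : w ^ 4 = w ^ 2 * w ^ 2 := by ring
    linarith [sq_nonneg (1 - w ^ 2), (by ring : (1 - w ^ 2) ^ 2 = 1 - 2 * w ^ 2 + w ^ 2 * w ^ 2)]
  have hw2' : w ^ 2 ≤ 1 := pow_le_one₀ hw0 hw1
  have hq : 0 < 1 - p := by linarith
  -- Working with 1/c, which lies in [1 - p, 1], turns the powers of c into harmless factors.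
  obtain ⟨r, hr⟩ : ∃ r, r = c⁻¹ := ⟨_, rfl⟩
  have hc0 : 0 < c := by linarith
  have hrc : r * c = 1 := by rw [hr]; exact inv_mul_cancel₀ hc0.ne'
  have hr0 : 0 < r := by rw [hr]; positivity
  have hr1 : r ≤ 1 := by
    have := mul_le_mul_of_nonneg_left hc1 hr0.le
    linarith
  have hrp : 1 - p ≤ r := by
    have := mul_le_mul_of_nonneg_left hc hr0.le
    rw [← mul_assoc, hrc] at this
    linarith
  have hr2 : 1 - 2 * p ≤ r ^ 2 := by
    have := pow_le_pow_left₀ hq.le hrp 2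
    linarith [sq_nonneg p, (by ring : (1 - p) ^ 2 = 1 - 2 * p + p ^ 2)]
  have hr2' : r ^ 2 ≤ 1 := pow_le_one₀ hr0.le hr1
  have hr4 : 1 - 4 * p ≤ r ^ 4 := by
    have : r ^ 4 = r ^ 2 * r ^ 2 := by ring
    linarith [sq_nonneg (1 - r ^ 2), (by ring : (1 - r ^ 2) ^ 2 = 1 - 2 * r ^ 2 + r ^ 2 * r ^ 2)]
  have hr4' : r ^ 4 ≤ 1 := pow_le_one₀ hr0.le hr1
  have hY' : r ^ 4 * (w ^ 4 * φ) ≤ Y + 3 * (r ^ 2 * w ^ 2) * φ ^ 2 * p := by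
    have h := mul_le_mul_of_nonneg_left hY (pow_nonneg hr0.le 4)
    have e : r ^ 4 * (c ^ 4 * Y + 3 * c ^ 2 * w ^ 2 * φ ^ 2 * p) =
        (r * c) ^ 4 * Y + 3 * (r * c) ^ 2 * (r ^ 2 * w ^ 2) * φ ^ 2 * p := by ring
    rw [e, hrc] at h
    linarith
  have g1 : r ^ 2 * w ^ 2 ≤ 1 := mul_le_one₀ hr2' (sq_nonneg w) hw2'
  have g2 : φ ^ 2 * p ≤ s ^ 2 * p :=
    mul_le_mul_of_nonneg_right (pow_le_pow_left₀ hφpos.le hφ 2) hp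
  have g3 : (r ^ 2 * w ^ 2) * (φ ^ 2 * p) ≤ 1 * (s ^ 2 * p) :=
    mul_le_mul g1 g2 (by positivity) zero_le_one
  have g4 : 1 - 4 * η - 4 * p ≤ r ^ 4 * w ^ 4 := by
    have hw4' : w ^ 4 ≤ 1 := pow_le_one₀ hw0 hw1
    linarith [mul_nonneg (sub_nonneg.2 hr4') (sub_nonneg.2 hw4')]
  have g5 : (1 - 4 * η - 4 * p) * φ ≤ r ^ 4 * w ^ 4 * φ :=
    mul_le_mul_of_nonneg_right g4 hφpos.le
  have g6 : (4 * η + 4 * p) * φ ≤ (4 * η + 4 * p) * s :=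
    mul_le_mul_of_nonneg_left hφ (by positivity)
  have g7 : (4 * η + 4 * p) * s = 8.04 * (s ^ 3 * p) + 4 * (s * δ) + 4 * (s * p) := by
    rw [hη]; ring
  -- The losses are 8.04 s³p + 4sδ + 3.5 s²p + 3.5 sp, at most 19.04/10000 and so below 1/500.
  linarith
end

/-! ### Closeness to a union of stars. -/

section
open Finset
open scoped InnerProductSpace

lemma pow_five_mul_div_le {n k s : ℕ} (hn : 10000 * s ^ 5 * k ≤ n) (hn0 : 0 < n) :
    10000 * ((s : ℝ) ^ 5 * ((k : ℝ) / n)) ≤ 1 := by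
  have h : (10000 * s ^ 5 * k : ℝ) ≤ n := by exact_mod_cast hn
  have hn' : (0 : ℝ) < n := by exact_mod_cast hn0
  have : 10000 * ((s : ℝ) ^ 5 * ((k : ℝ) / n)) = (10000 * s ^ 5 * k) / n := by ring
  rw [this, div_le_one hn']
  exact h

lemma mul_le_of_pow_five {n k s : ℕ} (hs : 1 ≤ s) (hn : 10000 * s ^ 5 * k ≤ n) :
    10000 * k ≤ n ∧ (1 ≤ k → 10000 * s ≤ n) := by
  have h1 : 1 ≤ s ^ 5 := Nat.one_le_pow _ _ hs
  have h2 : s ≤ s ^ 5 := Nat.le_self_pow (by norm_num) s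
  constructor
  · nlinarith
  · intro hk; nlinarith

/-- Numerical part of the estimate of the moments of the degrees of a family. -/
lemma moments_of_bounds {n k s p δ M L N b q lam f W c Q Y : ℝ} (hn0 : 0 < n) (hs : 1 ≤ s)
    (hk' : k = p * n) (hppos : 0 < p) (hp1 : p ≤ 1 / 10000)
    (hsp : 10000 * (s ^ 5 * p) ≤ 1) (hδ : 0 ≤ δ) (hsδ : 10000 * (s * δ) ≤ 1)
    (hM : 0 < M) (hL : 0 < L) (hN : 0 < N) (hb0 : 0 ≤ b) (hW0 : 0 ≤ W) (hQ0 : 0 ≤ Q)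
    (hMN : n * M = k * N) (hLlam : (n - k) * L = k * lam) (hb : b * (n - k) ≤ k * L)
    (hq : q * n ≤ k * M) (hF1 : s * M - s * (s - 1) / 2 * q ≤ f) (hF2 : f ≤ s * M)
    (hE : -(b * f) ≤ f * ((s - 1 + δ) * L) - (lam * f ^ 2 / N - L * W))
    (hc1 : 1 ≤ c) (hcp : c * (1 - p) ≤ 1) (d2 : W = M * c * Q) (d3 : W ≤ f)
    (hW4 : W ^ 4 ≤ f ^ 3 * (M * (c ^ 4 * Y) + 3 * (M ^ 2 / N) * ((c ^ 2) ^ 2 * Q ^ 2))) :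
    Q ≤ s ∧ s - 1 / 500 ≤ Y := by
  have hp0 := hppos.le
  have hMp : M = p * N := by
    have : n * M = n * (p * N) := by rw [hMN, hk']; ring
    exact mul_left_cancel₀ hn0.ne' this
  have hlam : lam * p = L * (1 - p) := by
    have : n * (lam * p) = n * (L * (1 - p)) := by
      rw [hk'] at hLlam
      linear_combination -hLlam
    exact mul_left_cancel₀ hn0.ne' this
  have hq' : q ≤ p * M := by
    have : n * q ≤ n * (p * M) := by rw [hk'] at hq; linarith
    exact le_of_mul_le_mul_left this hn0
  -- The 1.01 absorbs 1/(1 - p).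
  have hb' : b ≤ 1.01 * p * L := by
    have hb2 : b * (1 - 1 / 10000) ≤ b * (1 - p) := mul_le_mul_of_nonneg_left (by linarith) hb0
    have hpL : 0 ≤ p * L := by positivity
    have h1 : n * (b * (1 - p)) ≤ n * (p * L) := by rw [hk'] at hb; linarith
    have h2 := le_of_mul_le_mul_left h1 hn0
    linarith
  -- φ is the size of F in units of one star, close to s; w is the share of ‖1_F‖² carried by level
  -- one.
  obtain ⟨φ, hφdef⟩ : ∃ φ, φ = f / M := ⟨_, rfl⟩
  obtain ⟨w, hwdef⟩ : ∃ w, w = W / f := ⟨_, rfl⟩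
  have hFc : f = φ * M := by rw [hφdef]; field_simp
  have hφ : φ ≤ s := by rw [hφdef, div_le_iff₀ hM]; exact hF2
  have hφ' : s - s * (s - 1) / 2 * p ≤ φ := by
    rw [hφdef, le_div_iff₀ hM]
    have : s * (s - 1) / 2 * q ≤ s * (s - 1) / 2 * (p * M) :=
      mul_le_mul_of_nonneg_left hq' (by have : (0 : ℝ) ≤ s - 1 := by linarith
                                        positivity)
    linarith
  have hφpos : 0 < φ := by
    have a1 : (s : ℝ) ^ 2 ≤ s ^ 5 := pow_le_pow_right₀ hs (by norm_num)
    have a2 : (s : ℝ) ^ 2 * p ≤ s ^ 5 * p := mul_le_mul_of_nonneg_right a1 hp0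
    have a3 : 0 ≤ s * p := by positivity
    linarith
  have hFpos : (0 : ℝ) < f := by rw [hFc]; positivity
  have hWw : W = w * (φ * M) := by rw [hwdef, ← hFc]; field_simp
  have hw0 : 0 ≤ w := by rw [hwdef]; positivity
  have hw1 : w ≤ 1 := by rw [hwdef, div_le_one hFpos]; exact d3
  -- The degree-sum inequality divided by L|F|.
  have hw : (1 - p) * φ - 1.01 * p - (s - 1 + δ) ≤ w := by
    have h1 : lam * f ^ 2 / N = L * (1 - p) * φ * (φ * M) := by
      rw [← hlam, hFc, hMp]; field_simp
    have h2 : b * f ≤ 1.01 * p * L * f := mul_le_mul_of_nonneg_right hb' hFpos.le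
    rw [h1] at hE
    rw [hWw] at hE
    rw [hFc] at hE h2
    have h3 : (L * (φ * M)) * ((1 - p) * φ - 1.01 * p - (s - 1 + δ)) ≤ (L * (φ * M)) * w := by
      linarith
    exact le_of_mul_le_mul_left h3 (by positivity)
  have hQ : w * φ = c * Q := by
    have : M * (w * φ) = M * (c * Q) := by rw [← mul_assoc M c, ← d2, hWw]; ring
    exact mul_left_cancel₀ hM.ne' this
  have hY : w ^ 4 * φ ≤ c ^ 4 * Y + 3 * c ^ 2 * w ^ 2 * φ ^ 2 * p := by
    have h1 := hW4
    rw [hFc, hWw] at h1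
    have h2 : (φ * M) ^ 3 * (M * (c ^ 4 * Y) +
        3 * (M ^ 2 / N) * ((c ^ 2) ^ 2 * Q ^ 2)) =
        (φ ^ 3 * M ^ 4) * (c ^ 4 * Y + 3 * c ^ 2 * w ^ 2 * φ ^ 2 * p) := by
      have e1 : M ^ 2 / N = M * p := by rw [hMp]; field_simp
      have e2 : (c ^ 2 * Q) = c * (w * φ) := by rw [hQ]; ring
      rw [e1, ← mul_pow, e2]; ring
    rw [h2] at h1
    refine le_of_mul_le_mul_left (a := φ ^ 3 * M ^ 4) ?_ (by positivity)
    linarith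
  have h4 := pow_four_lower_bound hs hp0 hsp hδ hsδ hφ hφ' hw1 hw0 hw hc1 hcp hY
  refine ⟨?_, h4⟩
  have h5 : 1 * Q ≤ c * Q := mul_le_mul_of_nonneg_right hc1 hQ0
  have h6 : w * φ ≤ 1 * φ := mul_le_mul_of_nonneg_right hw1 hφpos.le
  linarith

/-- A family of the size of a union of `s` stars in which all degrees are nearly at most those in a
union of `s` stars is close to a union of `s` stars. -/
lemma exists_stars_close {n k s : ℕ} (hk : 1 ≤ k) (hs : 1 ≤ s) (hn : 10000 * s ^ 5 * k ≤ n)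
    {F : Finset (KSet n k)} (hF : F.card + (n - s).choose k = n.choose k) {δ : ℝ} (hδ : 0 ≤ δ)
    (hsδ : 10000 * (s * δ) ≤ 1)
    (hdeg : ∀ A ∈ F, (disjDeg F A : ℝ) ≤ (s - 1 + δ) * supCount (n - k) k 1) :
    ∃ S : Finset (Fin n), S.card = s ∧
      ((S.biUnion (kneserStar n k) \ F).card : ℝ) ≤ 1 / 250 * supCount n k 1 := by
  obtain ⟨hnk, hns⟩ := mul_le_of_pow_five hs hn
  have hns := hns hk
  set p : ℝ := (k : ℝ) / n with hp
  have hn0 : (0 : ℝ) < n := by exact_mod_cast (by omega : 0 < n)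
  have hp0 : 0 ≤ p := by positivity
  have hsp := pow_five_mul_div_le hn (by omega)
  rw [← hp] at hsp
  have hp1 : p ≤ 1 / 10000 := by
    rw [hp, div_le_iff₀ hn0]
    have : (10000 * k : ℝ) ≤ n := by exact_mod_cast hnk
    linarith
  have hk' : (k : ℝ) = p * n := by rw [hp]; field_simp
  have hk0 : (1 : ℝ) ≤ k := by exact_mod_cast hk
  have hkn : (k : ℝ) < n := by exact_mod_cast (by omega : k < n)
  have hsR : (1 : ℝ) ≤ s := by exact_mod_cast hs
  have hppos : 0 < p := by rw [hp]; positivity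
  -- binomial coefficients
  have hM := supCount_one_pos hk (by omega : 2 * k ≤ n)
  have hL := supCount_one_pos hk (by omega : 2 * k ≤ n - k)
  have hN : (0 : ℝ) < n.choose k := Nat.cast_pos.2 (Nat.choose_pos (by omega))
  have hMN := supCount_one_mul (n := n) (k := k) (by omega)
  have hLlam := supCount_one_mul (n := n - k) (k := k) (by omega)
  have hb := supCount_antitone (n := n - k) (k := k) (r := 1) (by omega) (by omega)
  have hq := supCount_antitone (n := n) (k := k) (r := 1) (by omega) (by omega)
  rw [Nat.cast_sub (by omega)] at hLlam hb
  obtain ⟨hF1, hF2⟩ := choose_sub_choose_bounds (m := n) (k := k) (s := s) hk (by omega)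
  have hFR : (n.choose k : ℝ) - ((n - s).choose k : ℕ) = F.card := by
    rw [sub_eq_iff_eq_add]; exact_mod_cast hF.symm
  rw [hFR] at hF1 hF2
  -- spectral decomposition
  obtain ⟨g, hg⟩ : ∃ g, g = linearFun k fun i => ((n : ℝ) - 1) / (n - k) * levelOneCoeff F i :=
    ⟨_, rfl⟩
  obtain ⟨d1, d2, d3, d4⟩ := level_decomposition hk (by omega) F
    (b := supCount (n - k) k 2) (fun h => by rw [supCount_of_le h]) (by positivity) hg
  have hz : ∑ i, ((n : ℝ) - 1) / (n - k) * levelOneCoeff F i = 0 := by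
    rw [← mul_sum, sum_levelOneCoeff hk (by omega), mul_zero]
  have hg4 := sum_linearFun_pow_four_le hk (by omega : 4 * k ≤ n) hz
  rw [← hg] at hg4
  have hW4 := sum_pow_four_le F (fun A => g A)
  have hsub : ∑ A ∈ F, g A ^ 4 ≤ ∑ A, g A ^ 4 :=
    sum_le_sum_of_subset_of_nonneg (subset_univ _) fun A _ _ => by positivity
  rw [d1] at hW4
  have hE : ∑ A ∈ F, (disjDeg F A : ℝ) ≤ F.card * ((s - 1 + δ) * supCount (n - k) k 1) := by
    rw [← nsmul_eq_mul]
    exact sum_le_card_nsmul _ _ _ hdeg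
  have hL1 : ((n - k - 1).choose (k - 1) : ℝ) = supCount (n - k) k 1 := by
    rw [supCount_of_le hk]
  rw [hL1] at d4
  have d4' := (abs_le.1 d4).1
  set y := levelOneCoeff F with hy
  set c : ℝ := ((n : ℝ) - 1) / (n - k) with hc
  have hc1 : 1 ≤ c := by rw [hc, one_le_div (by linarith)]; linarith
  have hcp : c * (1 - p) ≤ 1 := by
    have : n * (c * (1 - p)) ≤ n * 1 := by
      have e : n * (1 - p) = n - k := by rw [hk']; ring
      have : n * (c * (1 - p)) = n - 1 := by
        rw [mul_left_comm, e, hc]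
        field_simp [(by linarith : (n : ℝ) - k ≠ 0)]
      linarith
    exact le_of_mul_le_mul_left this hn0
  simp only [mul_pow, ← mul_sum] at hg4
  obtain ⟨h2, h4⟩ := moments_of_bounds hn0 hsR hk' hppos hp1 hsp hδ hsδ hM hL hN
    (Nat.cast_nonneg (supCount (n - k) k 2)) (sum_nonneg fun _ _ => sq_nonneg _)
    (sum_nonneg fun i (_ : i ∈ univ) => sq_nonneg (y i)) hMN hLlam (by norm_num at hb; exact hb)
    (by norm_num at hq; exact hq) hF1 hF2 (d4'.trans (sub_le_sub_right hE _)) hc1 hcp d2 d3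
    (hW4.trans (mul_le_mul_of_nonneg_left (hsub.trans hg4) (pow_nonneg (Nat.cast_nonneg _) 3)))
  clear d4 d4' hE hW4 hg4 hsub hb hq d1 d2 d3 hLlam hF1 hL1 hz hg hdeg
  obtain ⟨M, hMdef⟩ : ∃ M : ℝ, M = supCount n k 1 := ⟨_, rfl⟩
  obtain ⟨N, hNdef⟩ : ∃ N : ℝ, N = n.choose k := ⟨_, rfl⟩
  rw [← hMdef] at hM hMN hF2 ⊢
  rw [← hNdef] at hN hMN
  -- pointwise bounds
  have hx : ∀ i, ((F.filter fun A => i ∈ A.1).card : ℝ) ≤ M := by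
    intro i
    have := card_le_card (filter_subset_filter (fun A : KSet n k => i ∈ A.1) (subset_univ F))
    have h3 := card_filter_subset (k := k) ({i} : Finset (Fin n))
    simp only [singleton_subset_iff, card_singleton] at h3
    rw [h3] at this
    rw [hMdef]; exact_mod_cast this
  have hMp : M = p * N := by
    have : n * M = n * (p * N) := by rw [hMN, hk']; ring
    exact mul_left_cancel₀ hn0.ne' this
  have hαle : F.card / N ≤ s * p := by
    rw [div_le_iff₀ hN, mul_assoc, ← hMp]
    exact hF2
  have hα0 : (0 : ℝ) ≤ F.card / N := div_nonneg (Nat.cast_nonneg _) hN.le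
  have hsp1 : s * p ≤ 1 / 10000 := by
    have a1 : (s : ℝ) ≤ s ^ 5 := by
      have := pow_le_pow_right₀ hsR (by norm_num : 1 ≤ 5)
      simpa using this
    have a2 : (s : ℝ) * p ≤ s ^ 5 * p := mul_le_mul_of_nonneg_right a1 hp0
    linarith
  have hyx : ∀ i, y i = ((F.filter fun A => i ∈ A.1).card : ℝ) / M - F.card / N := by
    intro i; rw [hy, levelOneCoeff, hMdef, hNdef]
  have hyle : ∀ i, y i ≤ 1 := by
    intro i
    have : ((F.filter fun A => i ∈ A.1).card : ℝ) / M ≤ 1 := by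
      rw [div_le_one hM]; exact hx i
    rw [hyx]; linarith
  have hyge : ∀ i, -(1 / 10000) ≤ y i := by
    intro i
    have : 0 ≤ ((F.filter fun A => i ∈ A.1).card : ℝ) / M :=
      div_nonneg (Nat.cast_nonneg _) hM.le
    rw [hyx]; linarith
  obtain ⟨S, hS, hS1, hS2⟩ := exists_card_eq_of_sum_pow
    (fun i => (sq_le_one_iff_abs_le_one _).2
    (abs_le.2 ⟨by linarith [hyge i], hyle i⟩)) h2 h4
  refine ⟨S, hS, ?_⟩
  have hU : ((S.biUnion (kneserStar n k) \ F).card : ℝ) ≤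
      ∑ i ∈ S, ((kneserStar n k i \ F).card : ℝ) := by
    have : S.biUnion (kneserStar n k) \ F ⊆ S.biUnion fun i => kneserStar n k i \ F := by
      intro A; simp only [mem_sdiff, mem_biUnion]; tauto
    exact_mod_cast (card_le_card this).trans card_biUnion_le
  refine hU.trans ?_
  have hmiss : ∀ i ∈ S, ((kneserStar n k i \ F).card : ℝ) ≤ M * (1 - y i ^ 2) := by
    intro i hi
    have h3 := card_filter_subset (k := k) ({i} : Finset (Fin n))
    simp only [singleton_subset_iff, card_singleton] at h3
    have h5 : (kneserStar n k i \ F).card + (F.filter fun A => i ∈ A.1).card = supCount n k 1 := by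
      rw [← h3, ← card_sdiff_add_card_inter (univ.filter fun A : KSet n k => i ∈ A.1) F]
      congr 2
      ext A; simp [and_comm]
    have h6 : ((kneserStar n k i \ F).card : ℝ) + (F.filter fun A => i ∈ A.1).card = M := by
      rw [hMdef]; exact_mod_cast h5
    have h7 : ((F.filter fun A => i ∈ A.1).card : ℝ) = M * (y i + F.card / N) := by
      rw [hyx]; field_simp; ring
    -- Excludes y near -1: a negative coefficient is at least -1/10000, so its square cannot reach
    -- 1/2.
    have h8 : 0 ≤ y i := by
      by_contra h
      have := sq_le_sq' (hyge i) (by linarith : y i ≤ 1 / 10000)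
      linarith [hS1 i hi]
    have h9 : M * (1 - y i) ≤ M * (1 - y i ^ 2) :=
      mul_le_mul_of_nonneg_left (by
        have := mul_le_mul_of_nonneg_left (hyle i) h8
        rw [← sq, mul_one] at this
        linarith) hM.le
    have h10 : 0 ≤ M * (F.card / N) := mul_nonneg hM.le hα0
    linarith
  calc _ ≤ ∑ i ∈ S, M * (1 - y i ^ 2) := sum_le_sum hmiss
    _ = M * ∑ i ∈ S, (1 - y i ^ 2) := by rw [mul_sum]
    _ ≤ M * (1 / 250) := mul_le_mul_of_nonneg_left hS2 hM.le
    _ = _ := by ring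
end

/-! ### From closeness to equality by expander mixing. -/

section
open Finset

/-- Here m = |U \ F| and e is the degree sum inside the symmetric difference. The lower bound on e
is at least 0.9 mL, the mixing bound at most (4/250 + 2/1000) mL. -/
lemma mixing_numeric {n k s p δ M L N b lam m e : ℝ} (hn0 : 0 < n) (hs : 1 ≤ s)
    (hk' : k = p * n) (hppos : 0 < p) (hp1 : p ≤ 1 / 10000)
    (hsp : 10000 * (s ^ 5 * p) ≤ 1) (hδ : 0 ≤ δ) (hsδ : 10000 * (s * δ) ≤ 1)
    (hL : 0 < L) (hN : 0 < N) (hb0 : 0 ≤ b)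
    (hMN : n * M = k * N) (hLlam : (n - k) * L = k * lam) (hb : b * (n - k) ≤ k * L)
    (hm : m ≤ 1 / 250 * M) (hm0 : 0 ≤ m)
    (h1 : m * (s * L - s * (s - 1) / 2 * b - (s - 1 + δ) * L) ≤ e)
    (h2 : e ≤ lam * (2 * m) ^ 2 / N + b * (2 * m)) : m = 0 := by
  have hMp : M = p * N := by
    have : n * M = n * (p * N) := by rw [hMN, hk']; ring
    exact mul_left_cancel₀ hn0.ne' this
  have hlam : lam * p = L * (1 - p) := by
    have : n * (lam * p) = n * (L * (1 - p)) := by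
      rw [hk'] at hLlam
      linear_combination -hLlam
    exact mul_left_cancel₀ hn0.ne' this
  have hb' : b ≤ 1.01 * p * L := by
    have hb2 : b * (1 - 1 / 10000) ≤ b * (1 - p) :=
      mul_le_mul_of_nonneg_left (by linarith) hb0
    have hpL : 0 ≤ p * L := by positivity
    have h1 : n * (b * (1 - p)) ≤ n * (p * L) := by rw [hk'] at hb; linarith
    have h2 := le_of_mul_le_mul_left h1 hn0
    linarith
  have e1 : lam * (2 * m) ^ 2 / N = 4 * (lam * p) * m * (m / M) := by rw [hMp]; field_simp; ring
  have hMpos : 0 < M := by rw [hMp]; positivity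
  have hmM : m / M ≤ 1 / 250 := by rw [div_le_iff₀ hMpos]; exact hm
  have hmM0 : 0 ≤ m / M := by positivity
  have e2 : lam * (2 * m) ^ 2 / N ≤ 4 / 250 * (m * L) := by
    rw [e1, hlam]
    have a1 : L * (1 - p) * (m / M) ≤ L * (1 / 250) := by
      have : (1 - p) * (m / M) ≤ 1 * (1 / 250) :=
        mul_le_mul (by linarith) hmM hmM0 zero_le_one
      have := mul_le_mul_of_nonneg_left this hL.le
      linarith
    have := mul_le_mul_of_nonneg_left a1 hm0
    linarith
  have f5 : s ^ 2 * p ≤ s ^ 5 * p :=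
    mul_le_mul_of_nonneg_right (pow_le_pow_right₀ hs (by norm_num)) hppos.le
  have e3 : s * (s - 1) / 2 * b ≤ 1 / 1000 * L := by
    have a1 : s * (s - 1) / 2 * b ≤ s * (s - 1) / 2 * (1.01 * p * L) :=
      mul_le_mul_of_nonneg_left hb' (by have : 0 ≤ s - 1 := by linarith
                                        positivity)
    have a2 : s ^ 2 * p * L ≤ 1 / 10000 * L :=
      mul_le_mul_of_nonneg_right (by linarith) hL.le
    have a3 : 0 ≤ s * p * L := by positivity
    linarith
  have e4 : δ * L ≤ 1 / 10000 * L := by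
    have : δ ≤ s * δ := le_mul_of_one_le_left hδ hs
    exact mul_le_mul_of_nonneg_right (by linarith) hL.le
  have e5 : b ≤ 1 / 1000 * L := by
    have := mul_le_mul_of_nonneg_right hp1 hL.le
    linarith
  have e6 : m * (9 / 10 * L) ≤ m * (s * L - s * (s - 1) / 2 * b - (s - 1 + δ) * L) :=
    mul_le_mul_of_nonneg_left (by linarith) hm0
  have e7 : b * (2 * m) ≤ 1 / 1000 * L * (2 * m) :=
    mul_le_mul_of_nonneg_right e5 (by linarith)
  by_contra h
  have : 0 < m * L := by positivity
  linarith

/-- A family of the size of a union of `s` stars in which all degrees are nearly at most those in a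
union of `s` stars is a union of `s` stars. -/
theorem isUnionOfStars_of_disjDeg_le {n k s : ℕ} (hk : 1 ≤ k) (hs : 1 ≤ s)
    (hn : 10000 * s ^ 5 * k ≤ n)
    {F : Finset (KSet n k)} (hF : F.card + (n - s).choose k = n.choose k) {δ : ℝ} (hδ : 0 ≤ δ)
    (hsδ : 10000 * (s * δ) ≤ 1)
    (hdeg : ∀ A ∈ F, (disjDeg F A : ℝ) ≤ (s - 1 + δ) * supCount (n - k) k 1) :
    IsUnionOfStars s F := by
  obtain ⟨S, hS, hUF⟩ := exists_stars_close hk hs hn hF hδ hsδ hdeg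
  refine ⟨S, hS, ?_⟩
  have hUcard := card_biUnion_kneserStar (k := k) S
  have hUdeg := disjDeg_biUnion_kneserStar (k := k) S
  have hUmem := fun A => mem_biUnion_kneserStar (k := k) (S := S) (A := A)
  obtain ⟨U, hU⟩ : ∃ U, U = S.biUnion (kneserStar n k) := ⟨_, rfl⟩
  rw [← hU] at hUcard hUF ⊢
  simp only [← hU] at hUdeg hUmem
  rw [hS] at hUcard
  have hcard : F.card = U.card := by omega
  have hXY : (F \ U).card = (U \ F).card := card_sdiff_comm hcard
  suffices hm : ((U \ F).card : ℝ) = 0 by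
    have h0 : U \ F = ∅ := card_eq_zero.1 (by exact_mod_cast hm)
    exact (eq_of_subset_of_card_le (sdiff_eq_empty_iff_subset.1 h0) hcard.le).symm
  obtain ⟨hnk, hns⟩ := mul_le_of_pow_five hs hn
  have hns := hns hk
  have hn0 : (0 : ℝ) < n := by exact_mod_cast (by omega : 0 < n)
  have hk0 : (0 : ℝ) < k := by exact_mod_cast hk
  obtain ⟨g, hg⟩ : ∃ g, g = linearFun k fun i =>
    ((n : ℝ) - 1) / (n - k) * levelOneCoeff (F \ U ∪ U \ F) i := ⟨_, rfl⟩
  obtain ⟨-, -, -, d4⟩ := level_decomposition hk (by omega) (F \ U ∪ U \ F)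
    (b := supCount (n - k) k 2) (fun h => by rw [supCount_of_le h]) (Nat.cast_nonneg _) hg
  have hZ : ((F \ U ∪ U \ F).card : ℝ) = 2 * (U \ F).card := by
    rw [card_union_of_disjoint disjoint_sdiff_sdiff, hXY]; push_cast; ring
  rw [hZ] at d4
  have d5 := (abs_le.1 d4).2
  have hW : 0 ≤ ((n - k - 1).choose (k - 1) : ℝ) * ∑ A, g A ^ 2 :=
    mul_nonneg (Nat.cast_nonneg _) (sum_nonneg fun _ _ => sq_nonneg _)
  have hLlam := supCount_one_mul (n := n - k) (k := k) (by omega)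
  have hb := supCount_antitone (n := n - k) (k := k) (r := 1) (by omega) (by omega)
  rw [Nat.cast_sub (by omega)] at hLlam hb
  have hsum : ((U \ F).card : ℝ) * (s * supCount (n - k) k 1 -
      s * (s - 1) / 2 * supCount (n - k) k 2 - (s - 1 + δ) * supCount (n - k) k 1) ≤
      ∑ A ∈ F \ U ∪ U \ F, (disjDeg (F \ U ∪ U \ F) A : ℝ) := by
    rw [← hXY, ← nsmul_eq_mul]
    refine le_trans ?_ (sum_le_sum_of_subset_of_nonneg subset_union_left
      fun _ _ _ => Nat.cast_nonneg _)
    -- Such an A misses S, so it has nearly s·L neighbours in U; those exceeding its degree in F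
    -- must lie in U \ F.
    refine card_nsmul_le_sum _ _ _ fun A hA => ?_
    obtain ⟨hAF, hAU⟩ := mem_sdiff.1 hA
    have hAS : Disjoint S A.1 := by
      by_contra h
      exact hAU ((hUmem A).2 h)
    have h1 := hUdeg A
    rw [card_union_of_disjoint hAS.symm, A.2, hS, ← Nat.sub_sub] at h1
    have h2 := (choose_sub_choose_bounds (m := n - k) (k := k) (s := s) hk (by omega)).1
    have h3 : disjDeg U A ≤ disjDeg F A + disjDeg (F \ U ∪ U \ F) A := by
      refine le_trans (card_le_card ?_) (card_union_le _ _)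
      intro B hB
      simp only [mem_filter, mem_union, mem_sdiff] at hB ⊢
      tauto
    have h1' : (disjDeg U A : ℝ) + ((n - k - s).choose k : ℕ) = ((n - k).choose k : ℕ) := by
      exact_mod_cast h1
    have h3' : (disjDeg U A : ℝ) ≤ disjDeg F A + disjDeg (F \ U ∪ U \ F) A := by
      exact_mod_cast h3
    have h4 := hdeg A hAF
    linarith
  have hp1 : (k : ℝ) / n ≤ 1 / 10000 := by
    rw [div_le_iff₀ hn0]
    have : (10000 * k : ℝ) ≤ n := by exact_mod_cast hnk
    linarith
  refine mixing_numeric (p := (k : ℝ) / n) hn0 (by exact_mod_cast hs : (1 : ℝ) ≤ s)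
    (by field_simp) (div_pos hk0 hn0) hp1 (pow_five_mul_div_le hn (by omega)) hδ hsδ
    (supCount_one_pos hk (by omega : 2 * k ≤ n - k))
    (Nat.cast_pos.2 (Nat.choose_pos (by omega : k ≤ n))) (Nat.cast_nonneg _)
    (supCount_one_mul (by omega)) hLlam (by norm_num at hb; exact hb) hUF (Nat.cast_nonneg _)
    hsum ?_
  linarith

end

/-! ### Deduction of both parts of the corollary. -/

section
open Finset

lemma degree_induce_kneserGraph {n k : ℕ} (hk : 1 ≤ k) (F : Finset (KSet n k))
    (v : (F : Set (KSet n k)))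
    [Fintype (((kneserGraph n k).induce (F : Set (KSet n k))).neighborSet v)] :
    ((kneserGraph n k).induce (F : Set (KSet n k))).degree v = disjDeg F v.1 := by
  rw [← SimpleGraph.card_neighborFinset_eq_degree, disjDeg]
  refine card_bij (fun B _ => B.1) ?_ (fun _ _ _ _ h => Subtype.ext h) ?_
  · intro B hB
    rw [SimpleGraph.mem_neighborFinset, SimpleGraph.comap_adj] at hB
    exact mem_filter.2 ⟨B.2, hB.2⟩
  · intro B hB
    obtain ⟨hBF, hd⟩ := mem_filter.1 hB
    refine ⟨⟨B, hBF⟩, ?_, rfl⟩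
    rw [SimpleGraph.mem_neighborFinset, SimpleGraph.comap_adj]
    refine ⟨fun h => ?_, hd⟩
    have hvB : v.1 = B := h
    rw [hvB, disjoint_self] at hd
    have := B.2
    rw [hd] at this
    simp at this
    omega

lemma inducedMaxDegree_le_iff {n k d : ℕ} (hk : 1 ≤ k) (F : Finset (KSet n k)) :
    inducedMaxDegree F ≤ d ↔ ∀ A ∈ F, disjDeg F A ≤ d := by
  classical
  have hdef : inducedMaxDegree F =
      ((kneserGraph n k).induce (F : Set (KSet n k))).maxDegree := by
    unfold inducedMaxDegree
    convert rfl
  rw [hdef]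
  constructor
  · intro h A hA
    refine le_trans (le_of_eq ?_) ((SimpleGraph.degree_le_maxDegree _ ⟨A, hA⟩).trans h)
    exact (degree_induce_kneserGraph hk F ⟨A, hA⟩).symm
  · intro h
    apply SimpleGraph.maxDegree_le_of_forall_degree_le
    intro v
    rw [degree_induce_kneserGraph hk]
    exact h v.1 v.2

/-- An integer parameter s is an endpoint of two admissible intervals, t = s - 1 and t = s; Pascal's
rule makes the two sizes agree. -/
lemma HasSizeParameter.card_add_choose {n k s : ℕ} (hk : 1 ≤ k) {F : Finset (KSet n k)}
    (h : HasSizeParameter F (s : ℝ)) : F.card + (n - s).choose k = n.choose k := by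
  obtain ⟨t, ht, h1, h2, h3⟩ := h
  have h1' : t ≤ s := by exact_mod_cast h1
  have h2' : s ≤ t + 1 := by exact_mod_cast h2
  rcases Nat.lt_or_ge t s with hlt | hge
  · have hst : s = t + 1 := by omega
    subst hst
    have := choose_sub_sub_choose_succ (m := n) (s := t) hk (by omega)
    have h4 : ((n - t).choose k : ℝ) =
      ((n - t - 1).choose (k - 1) : ℕ) + ((n - (t + 1)).choose k : ℕ) := by exact_mod_cast this
    rw [h4] at h3
    push_cast at h3
    have : (F.card : ℝ) + ((n - (t + 1)).choose k : ℕ) = (n.choose k : ℕ) := by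
      linarith
    exact_mod_cast this
  · have hst : s = t := by omega
    subst hst
    have : (F.card : ℝ) + ((n - s).choose k : ℕ) = (n.choose k : ℕ) := by
      linarith
    exact_mod_cast this

/-- A meets S, so a neighbour of A can only use the at most |S| - 1 points of S outside A. -/
lemma disjDeg_biUnion_kneserStar_le {n k : ℕ} (hk : 1 ≤ k) {S : Finset (Fin n)}
    (hn : S.card + k ≤ n) {A : KSet n k} (hA : A ∈ S.biUnion (kneserStar n k)) :
    (disjDeg (S.biUnion (kneserStar n k)) A : ℝ) ≤ (S.card - 1) * supCount (n - k) k 1 := by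
  have h1 := disjDeg_biUnion_kneserStar S A
  rw [mem_biUnion_kneserStar, not_disjoint_iff] at hA
  obtain ⟨i, hiS, hiA⟩ := hA
  have h2 := card_union_add_card_inter A.1 S
  have h3 : 1 ≤ (A.1 ∩ S).card := card_pos.2 ⟨i, mem_inter.2 ⟨hiA, hiS⟩⟩
  have h4 : 1 ≤ S.card := card_pos.2 ⟨i, hiS⟩
  rw [A.2] at h2
  have h5 := (choose_sub_choose_bounds (m := n - k) (k := k) (s := S.card - 1) hk (by omega)).2
  have h6 : (n - k - (S.card - 1)).choose k ≤ (n - (A.1 ∪ S).card).choose k :=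
    Nat.choose_le_choose _ (by omega)
  have h6' : ((n - k - (S.card - 1)).choose k : ℝ) ≤ ((n - (A.1 ∪ S).card).choose k : ℕ) := by
    exact_mod_cast h6
  have h1' : (disjDeg (S.biUnion (kneserStar n k)) A : ℝ) + ((n - (A.1 ∪ S).card).choose k : ℕ) =
      ((n - k).choose k : ℕ) := by exact_mod_cast h1
  rw [Nat.cast_sub h4, Nat.cast_one] at h5
  linarith

theorem MinimizesMaxDegree.isUnionOfStars {n k s : ℕ} (hk : 1 ≤ k) (hs : 1 ≤ s)
    (hn : 10000 * s ^ 5 * k ≤ n) {F : Finset (KSet n k)} (hF : HasSizeParameter F (s : ℝ))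
    (hmin : MinimizesMaxDegree F) : IsUnionOfStars s F := by
  obtain ⟨hnk, hns⟩ := mul_le_of_pow_five hs hn
  have hns := hns hk
  have hcard := hF.card_add_choose hk
  obtain ⟨S, -, hS⟩ := exists_subset_card_eq (s := (univ : Finset (Fin n))) (n := s)
    (by rw [card_univ, Fintype.card_fin]; omega)
  have hUcard := card_biUnion_kneserStar (k := k) S
  rw [hS] at hUcard
  have hle := hmin (S.biUnion (kneserStar n k)) (by omega)
  have hL0 : (0 : ℝ) ≤ supCount (n - k) k 1 := Nat.cast_nonneg _
  have hU : inducedMaxDegree (S.biUnion (kneserStar n k)) ≤ (s - 1) * supCount (n - k) k 1 := by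
    rw [inducedMaxDegree_le_iff hk]
    intro A hA
    have := disjDeg_biUnion_kneserStar_le hk (by omega) hA
    rw [hS] at this
    have h : (disjDeg (S.biUnion (kneserStar n k)) A : ℝ) ≤
        (((s - 1) * supCount (n - k) k 1 : ℕ) : ℝ) := by
      push_cast [Nat.cast_sub hs]; exact this
    exact_mod_cast h
  have hdeg := (inducedMaxDegree_le_iff hk F).1 (hle.trans hU)
  refine isUnionOfStars_of_disjDeg_le hk hs hn hcard le_rfl (by norm_num) fun A hA => ?_
  have h : (disjDeg F A : ℝ) ≤ (((s - 1) * supCount (n - k) k 1 : ℕ) : ℝ) := by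
    exact_mod_cast hdeg A hA
  push_cast [Nat.cast_sub hs] at h
  linarith

lemma isUnionOfStars_one_iff {n k : ℕ} {F : Finset (KSet n k)} :
    IsUnionOfStars 1 F ↔ ∃ i, F = kneserStar n k i := by
  constructor
  · rintro ⟨S, hS, rfl⟩
    obtain ⟨i, rfl⟩ := card_eq_one.1 hS
    exact ⟨i, by simp⟩
  · rintro ⟨i, rfl⟩
    exact ⟨{i}, by simp, by simp⟩

lemma card_kneserStar {n k : ℕ} (i : Fin n) :
    (kneserStar n k i).card + (n - 1).choose k = n.choose k := by
  have := card_biUnion_kneserStar (k := k) {i}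
  simpa using this

lemma disjDeg_kneserStar_of_mem {n k : ℕ} {i : Fin n} {A : KSet n k} (hA : i ∈ A.1) :
    disjDeg (kneserStar n k i) A = 0 := by
  rw [disjDeg, card_eq_zero, filter_eq_empty_iff]
  intro B hB hd
  exact disjoint_left.1 hd hA (mem_kneserStar.1 hB)

lemma disjDeg_kneserStar_of_notMem {n k : ℕ} (hk : 1 ≤ k) {i : Fin n} {A : KSet n k}
    (hA : i ∉ A.1) : disjDeg (kneserStar n k i) A = (n - k - 1).choose (k - 1) := by
  have h1 := disjDeg_biUnion_kneserStar {i} A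
  have h2 : (A.1 ∪ {i}).card = k + 1 := by
    rw [card_union_of_disjoint (by simpa using hA), A.2, card_singleton]
  have h3 : k + 1 ≤ n := by
    rw [← h2]; simpa using card_le_univ (A.1 ∪ {i})
  have h4 := choose_sub_sub_choose_succ (m := n - k) (s := 0) hk (by omega)
  rw [h2, singleton_biUnion, ← Nat.sub_sub] at h1
  simp only [Nat.sub_zero, zero_add] at h4
  omega

lemma isAlmostIntersecting_kneserStar {n k l : ℕ} (hk : 1 ≤ k) (i : Fin n) :
    IsAlmostIntersecting l (kneserStar n k i) := by
  rw [IsAlmostIntersecting, inducedMaxDegree_le_iff hk]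
  intro A hA
  rw [disjDeg_kneserStar_of_mem (mem_kneserStar.1 hA)]
  exact Nat.zero_le _

lemma disjDeg_mono {n k : ℕ} {F G : Finset (KSet n k)} (h : F ⊆ G) (A : KSet n k) :
    disjDeg F A ≤ disjDeg G A :=
  card_le_card (filter_subset_filter _ h)

/-- An almost intersecting family at least as large as a star is a star. -/
lemma IsAlmostIntersecting.eq_kneserStar {n k l : ℕ} (hk : 1 ≤ k) (hn : 10000 * k ≤ n)
    (hl : 10000 * l ≤ (n - k - 1).choose (k - 1)) {F : Finset (KSet n k)}
    (hF : IsAlmostIntersecting l F) (hcard : n.choose k ≤ F.card + (n - 1).choose k) :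
    ∃ i, F = kneserStar n k i := by
  rw [IsAlmostIntersecting, inducedMaxDegree_le_iff hk] at hF
  have hle : (n - 1).choose k ≤ n.choose k := Nat.choose_le_choose _ (by omega)
  -- Trimming to exactly the size of a star preserves the degree bound, so stability applies to G. A
  -- further set of F outside that star would have more than l neighbours in it.
  obtain ⟨G, hGF, hG⟩ := exists_subset_card_eq (s := F) (n := n.choose k - (n - 1).choose k)
    (by omega)
  have hstar : IsUnionOfStars 1 G := by
    refine isUnionOfStars_of_disjDeg_le (δ := 1 / 10000) hk le_rfl (by omega) (by omega)
      (by norm_num) (by norm_num) fun A hA => ?_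
    have h1 : disjDeg G A ≤ l := (disjDeg_mono hGF A).trans (hF A (hGF hA))
    have h2 : 10000 * disjDeg G A ≤ supCount (n - k) k 1 := by
      rw [supCount_of_le hk]; omega
    have h3 : (10000 * disjDeg G A : ℝ) ≤ supCount (n - k) k 1 := by exact_mod_cast h2
    push_cast
    linarith
  obtain ⟨i, rfl⟩ := isUnionOfStars_one_iff.1 hstar
  refine ⟨i, (hGF.antisymm fun A hA => ?_).symm⟩
  by_contra h
  have h1 := disjDeg_kneserStar_of_notMem hk fun hi => h (mem_kneserStar.2 hi)
  have h2 := (disjDeg_mono hGF A).trans (hF A hA)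
  have h3 : 0 < (n - k - 1).choose (k - 1) := Nat.choose_pos (by omega)
  omega

lemma isLargestAlmostIntersecting_iff {n k l : ℕ} (hk : 1 ≤ k) (hn : 10000 * k ≤ n)
    (hl : 10000 * l ≤ (n - k - 1).choose (k - 1)) (F : Finset (KSet n k)) :
    IsLargestAlmostIntersecting l F ↔ ∃ i, F = kneserStar n k i := by
  constructor
  · rintro ⟨h1, h2⟩
    have i : Fin n := ⟨0, by omega⟩
    have h3 := h2 _ (isAlmostIntersecting_kneserStar hk i)
    have h4 := card_kneserStar (k := k) i
    exact h1.eq_kneserStar hk hn hl (by omega)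
  · rintro ⟨i, rfl⟩
    refine ⟨isAlmostIntersecting_kneserStar hk i, fun G hG => ?_⟩
    by_contra! h
    have h4 := card_kneserStar (k := k) i
    obtain ⟨j, rfl⟩ := hG.eq_kneserStar hk hn hl (by omega)
    have h5 := card_kneserStar (k := k) j
    omega

/-- A star together with one more set is almost intersecting if `l` is large. -/
lemma not_mem_starThresholds {n k l : ℕ} (hk : 1 ≤ k) (hl1 : 1 ≤ l) (hn : k + 1 ≤ n)
    (hl : (n - k - 1).choose (k - 1) ≤ l) : n ∉ starThresholds k l := by
  rintro ⟨-, h⟩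
  have i : Fin n := ⟨0, by omega⟩
  obtain ⟨-, hmax⟩ := (h n le_rfl (kneserStar n k i)).2 ⟨i, rfl⟩
  obtain ⟨A, hA, hAc⟩ := exists_subset_card_eq (s := univ.erase i) (n := k)
    (by rw [card_erase_of_mem (mem_univ i), card_univ, Fintype.card_fin]; omega)
  have hiA : i ∉ A := fun hi => (mem_erase.1 (hA hi)).1 rfl
  have hmem : (⟨A, hAc⟩ : KSet n k) ∉ kneserStar n k i := fun h => hiA (mem_kneserStar.1 h)
  have hAI : IsAlmostIntersecting l (insert ⟨A, hAc⟩ (kneserStar n k i)) := by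
    rw [IsAlmostIntersecting, inducedMaxDegree_le_iff hk]
    intro B hB
    rcases mem_insert.1 hB with rfl | hB
    · refine le_trans ?_ hl
      rw [← disjDeg_kneserStar_of_notMem (A := ⟨A, hAc⟩) hk hiA, disjDeg, disjDeg, filter_insert,
        if_neg]
      intro hd
      rw [disjoint_self] at hd
      have hd' : A = ∅ := hd
      rw [hd', card_empty] at hAc
      omega
    · have h0 := disjDeg_kneserStar_of_mem (mem_kneserStar.1 hB)
      rw [disjDeg] at h0 ⊢
      rw [filter_insert]
      split_ifs
      · exact (card_insert_le _ _).trans (by omega)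
      · omega
  have := hmax _ hAI
  rw [card_insert_of_notMem hmem] at this
  omega

lemma starThresholds_upward {k l M N : ℕ} (hM : M ∈ starThresholds k l) (h : M ≤ N) :
    N ∈ starThresholds k l :=
  ⟨hM.1.trans_le h, fun n hn => hM.2 n (h.trans hn)⟩

lemma exists_root {k l : ℕ} (hk : 2 ≤ k) (hl : 1 ≤ l) :
    ∃ x : ℝ, 1 ≤ x ∧ x ^ (k - 1) = l ∧ (l : ℝ) ^ (1 / ((k : ℝ) - 1)) = x := by
  have hl' : (1 : ℝ) ≤ l := by exact_mod_cast hl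
  have hc : ((k - 1 : ℕ) : ℝ) = (k : ℝ) - 1 := by rw [Nat.cast_sub (by omega)]; simp
  refine ⟨_, ?_, ?_, rfl⟩
  · refine Real.one_le_rpow hl' ?_
    rw [← hc]; positivity
  · rw [← hc, one_div]
    exact Real.rpow_inv_natCast_pow (by linarith) (by omega)

/-- The 3 comes from r^r / r! ≤ e^r ≤ 3^r. -/
lemma choose_le_of_le_root {m r : ℕ} (hr : 1 ≤ r) {x : ℝ} (hm : (m : ℝ) ≤ r * x / 3) :
    (m.choose r : ℝ) ≤ x ^ r := by
  have hr0 : (0 : ℝ) < r := by exact_mod_cast hr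
  have h1 : (m.choose r : ℝ) ≤ (m : ℝ) ^ r / (r.factorial : ℝ) := Nat.choose_le_pow_div r m
  have h2 := Real.pow_div_factorial_le_exp (r : ℝ) hr0.le r
  have h3 : Real.exp r ≤ 3 ^ r := by
    rw [← Real.exp_one_pow]
    exact pow_le_pow_left₀ (Real.exp_pos 1).le Real.exp_one_lt_three.le r
  have hm0 : (0 : ℝ) ≤ m := Nat.cast_nonneg m
  have h4 : (3 * m / r : ℝ) ≤ x := by rw [div_le_iff₀ hr0]; linarith
  calc (m.choose r : ℝ) ≤ (m : ℝ) ^ r / (r.factorial : ℝ) := h1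
    _ = (m / r : ℝ) ^ r * ((r : ℝ) ^ r / (r.factorial : ℝ)) := by
        rw [div_pow]; field_simp
    _ ≤ (m / r : ℝ) ^ r * 3 ^ r := mul_le_mul_of_nonneg_left (h2.trans h3) (by positivity)
    _ = (3 * m / r : ℝ) ^ r := by rw [← mul_pow]; ring
    _ ≤ x ^ r := pow_le_pow_left₀ (by positivity) h4 r

/-- Uses C(m, r) ≥ ((m - r + 1)/r)^r, from r! ≤ r^r. Half of the 20000 pays for subtracting k and r
from n, and 10000^r ≥ 10000 as r ≥ 1. -/
lemma le_choose_of_root_le {n k : ℕ} (hk : 2 ≤ k) {x : ℝ} (hx : 1 ≤ x)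
    (hn : 20000 * (k * x) ≤ n) :
    10000 * x ^ (k - 1) ≤ ((n - k - 1).choose (k - 1) : ℝ) := by
  have hk2 : (2 : ℝ) ≤ k := by exact_mod_cast hk
  have hnk : (20000 * k : ℝ) ≤ n := by nlinarith
  have hnk' : 20000 * k ≤ n := by exact_mod_cast hnk
  obtain ⟨r, hr⟩ : ∃ r, k = r + 1 := ⟨k - 1, by omega⟩
  have hr1 : 1 ≤ r := by omega
  have hr0 : (0 : ℝ) < r := by exact_mod_cast hr1
  have e : k - 1 = r := by omega
  rw [e]
  have h1 := Nat.pow_sub_le_descFactorial (n - k - 1) r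
  rw [Nat.descFactorial_eq_factorial_mul_choose] at h1
  have h2 : r.factorial ≤ r ^ r := Nat.factorial_le_pow r
  have h3 := h1.trans (Nat.mul_le_mul_right _ h2)
  have h4 : ((n - k - 1 + 1 - r : ℕ) : ℝ) ^ r ≤ (r : ℝ) ^ r * ((n - k - 1).choose r : ℕ) := by
    exact_mod_cast h3
  have h5 : ((n - k - 1 + 1 - r : ℕ) : ℝ) = n - k - r := by
    have : n - k - 1 + 1 - r = n - k - r := by omega
    rw [this, Nat.cast_sub (by omega), Nat.cast_sub (by omega)]
  have hkr : (k : ℝ) = r + 1 := by rw [hr]; push_cast; ring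
  have h6 : 10000 * (r * x) ≤ (n : ℝ) - k - r := by
    rw [hkr] at hn hnk ⊢
    nlinarith
  rw [h5] at h4
  have h7 := (pow_le_pow_left₀ (by positivity) h6 r).trans h4
  rw [mul_pow, mul_pow] at h7
  have h8 : (10000 : ℝ) ≤ 10000 ^ r := by
    simpa using pow_le_pow_right₀ (by norm_num : (1 : ℝ) ≤ 10000) hr1
  have h9 : (r : ℝ) ^ r * (10000 ^ r * x ^ r) ≤ (r : ℝ) ^ r * ((n - k - 1).choose r : ℕ) := by
    linarith
  have h10 := le_of_mul_le_mul_left h9 (by positivity)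
  exact (mul_le_mul_of_nonneg_right h8 (by positivity)).trans h10

theorem isStarThreshold_bounds {k l : ℕ} (hk : 2 ≤ k) (hl : 1 ≤ l) :
    ∃ N : ℕ, IsStarThreshold k l N ∧
      1 / 6 * ((k : ℝ) * (l : ℝ) ^ (1 / ((k : ℝ) - 1))) ≤ (N : ℝ) ∧
      (N : ℝ) ≤ 20001 * ((k : ℝ) * (l : ℝ) ^ (1 / ((k : ℝ) - 1))) := by
  obtain ⟨x, hx1, hxl, hx⟩ := exists_root hk hl
  rw [hx]
  have hk2 : (2 : ℝ) ≤ k := by exact_mod_cast hk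
  have hkx : (1 : ℝ) ≤ k * x := by nlinarith
  have hmem : ⌈20000 * (k * x)⌉₊ ∈ starThresholds k l := by
    refine ⟨Nat.ceil_pos.2 (by positivity), fun n hn F => ?_⟩
    have hn' : 20000 * (k * x) ≤ n := Nat.ceil_le.1 hn
    have h1 := le_choose_of_root_le hk hx1 hn'
    rw [hxl] at h1
    have h2 : (10000 * k : ℝ) ≤ n := by nlinarith
    exact isLargestAlmostIntersecting_iff (by omega) (by exact_mod_cast h2)
      (by exact_mod_cast h1) F
  have hleast : IsStarThreshold k l (sInf (starThresholds k l)) :=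
    ⟨Nat.sInf_mem ⟨_, hmem⟩, fun _ h => Nat.sInf_le h⟩
  refine ⟨_, hleast, ?_, ?_⟩
  · obtain ⟨N, hN⟩ : ∃ N, N = sInf (starThresholds k l) := ⟨_, rfl⟩
    rw [← hN] at hleast ⊢
    -- The largest m to which `choose_le_of_le_root` applies with r = k - 1. At n = k + 1 + m a star
    -- can be enlarged, so N > n, and (k-1)/3 ≥ k/6 for k ≥ 2 gives the constant 1/6.
    set m := ⌊((k - 1 : ℕ) : ℝ) * x / 3⌋₊ with hm
    have hm1 : (m : ℝ) ≤ ((k - 1 : ℕ) : ℝ) * x / 3 := Nat.floor_le (by positivity)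
    have hm2 : ((k - 1 : ℕ) : ℝ) * x / 3 < m + 1 := Nat.lt_floor_add_one _
    have h1 := choose_le_of_le_root (by omega) hm1
    rw [hxl] at h1
    have h2 : m.choose (k - 1) ≤ l := by exact_mod_cast h1
    have h3 : k + 1 + m ∉ starThresholds k l :=
      not_mem_starThresholds (by omega) hl (by omega)
        (by rwa [(by omega : k + 1 + m - k - 1 = m)])
    have h4 : k + 1 + m < N := by
      by_contra! h
      exact h3 (starThresholds_upward hleast.1 h)
    have h5 : (k + 1 + m : ℝ) < N := by exact_mod_cast h4
    rw [Nat.cast_sub (by omega), Nat.cast_one] at hm2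
    nlinarith
  · have h1 : ((sInf (starThresholds k l) : ℕ) : ℝ) ≤ ⌈20000 * (k * x)⌉₊ := by
      exact_mod_cast Nat.sInf_le hmem
    -- Rounding up costs less than 1 ≤ kx, hence 20001.
    have h2 := Nat.ceil_lt_add_one (by positivity : 0 ≤ 20000 * (k * x))
    linarith
end

theorem mainTheorem3 :
    (∀ n k s : ℕ, 1 ≤ k → 1 ≤ s → 10000 * s ^ 5 * k ≤ n →
      ∀ F : Finset (KSet n k), HasSizeParameter F (s : ℝ) → MinimizesMaxDegree F →
        IsUnionOfStars s F) ∧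
    (∃ c C : ℝ, 0 < c ∧ 0 < C ∧ ∀ k l : ℕ, 2 ≤ k → 1 ≤ l →
      ∃ N : ℕ, IsStarThreshold k l N ∧
        c * ((k : ℝ) * (l : ℝ) ^ (1 / ((k : ℝ) - 1))) ≤ (N : ℝ) ∧
        (N : ℝ) ≤ C * ((k : ℝ) * (l : ℝ) ^ (1 / ((k : ℝ) - 1)))) :=
  ⟨fun _ _ _ hk hs hn _ hF hmin => hmin.isUnionOfStars hk hs hn hF,
    1 / 6, 20001, by norm_num, by norm_num, fun _ _ hk hl => isStarThreshold_bounds hk hl⟩
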